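/- Let $k$ be a field and let $E=(E^0,E^1,r,s)$ be a row-finite directed graph, i.e. $s^{-1}(v)$ is finite for every vertex $v$. Let $L(E)=L_k(E)$ be its Leavitt path algebra: the (not necessarily unital) associative $k$-algebra generated by $E^0\cup E^1\cup\{e^*: e\in E^1\}$ with relations $vw=\delta_{v,w}v$; $s(e)e=e=e\,r(e)$; $r(e)e^*=e^*=e^*s(e)$; $e^*f=\delta_{e,f}r(e)$; and $v=\sum_{s(e)=v}ee^*$ for every vertex $v$ that is not a sink. It is $\mathbb Z$-graded by $\deg v=0$, $\deg e=1$, $\deg e^*=-1$. For a ring $A$ with local units (such as $L(E)$), let $\mathcal V(A)$ be the monoid of equivalence classes of idempotent matrices over $A$ under block sum, where $p\sim q$ if $p=xy$ and $q=yx$ for some matrices $x,y$; let $K_0(A)$ be its group completion. If $A=\bigoplus_n A_n$ is $\mathbb Z$-graded, let $\mathcal V^{\rm gr}(A)$ be the monoid of classes of pairs consisting of shifts $(d_1,\dots,d_n)\in\mathbb Z^n$ and an idempotent $n\times n$ matrix $p$ with $p_{ij}\in A_{d_j-d_i}$ (representing the graded projective left module $(A(d_1)\oplus\dots\oplus A(d_n))p$,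 where $A(d)_m=A_{m+d}$), with $(d,p)\sim(d',q)$ if $p=xy$, $q=yx$ for matrices with $x_{ij}\in A_{d'_j-d_i}$ and $y_{ij}\in A_{d_j-d'_i}$; let $K_0^{\rm gr}(A)$ be its group completion. Let $U:K_0^{\rm gr}(A)\to K_0(A)$ be the homomorphism induced by forgetting the grading. For $v\in E^0$ and $i\in\mathbb Z$ let $v(i)=[(L(E)v)(-i)]\in K_0^{\rm gr}(L(E))$, the class of the $1\times1$ matrix $v$ with shift $-i$. Then there is a unique group homomorphism $\phi:K_0^{\rm gr}(L(E))\to K_0^{\rm gr}(L(E))$ with $\phi(v(i))=v(i+1)-v(i)$ for all $v\in E^0$ and $i\in\mathbb Z$, and the sequence $$K_0^{\rm gr}(L(E))\xrightarrow{\ \phi\ }K_0^{\rm gr}(L(E))\xrightarrow{\ U\ }K_0(L(E))\longrightarrow 0$$ is exact. -/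

import Mathlib

/-! ## Directed graphs -/

/-- A directed graph `(E⁰, E¹, r, s)`; each edge `e` points from `src e` to `rng e`. -/
structure DirGraph.{u, v} where
  /-- the set of vertices -/
  Vert : Type u
  /-- the set of edges -/
  Edge : Type v
  /-- the source map -/
  src : Edge → Vert
  /-- the range map -/
  rng : Edge → Vert

namespace DirGraph

/-- Every vertex emits only finitely many edges. -/
def RowFinite (E : DirGraph) : Prop :=
  ∀ v : E.Vert, {e : E.Edge | E.src e = v}.Finite

/-- The generators `v`, `e`, `e*` of the Leavitt path algebra. -/
inductive Gen (E : DirGraph)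
  | vert (v : E.Vert) : Gen E
  | edge (e : E.Edge) : Gen E
  | ghost (e : E.Edge) : Gen E

/-- Degrees of the generators: vertices have degree `0`, edges `1`, ghost edges `-1`. -/
def Gen.degree {E : DirGraph} : Gen E → ℤ
  | .vert _ => 0
  | .edge _ => 1
  | .ghost _ => -1

/-- The degree of a nonempty word in the generators (the sum of the degrees of its letters). -/
def wordDegree (E : DirGraph) : FreeSemigroup (Gen E) →ₙ* Multiplicative ℤ :=
  FreeSemigroup.lift fun x => Multiplicative.ofAdd x.degree

end DirGraph

/-! ## Leavitt path algebras -/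

namespace Leavitt

open DirGraph

section Algebra

variable (k : Type*) [Field k] (E : DirGraph)

/-- The free associative (not necessarily unital) `k`-algebra on the generators `v`, `e`, `e*`:
its `k`-basis consists of the nonempty words. -/
abbrev FreeAlg : Type _ := MonoidAlgebra k (FreeSemigroup (Gen E))

variable {E} in
/-- A generator, as an element of the free algebra. -/
noncomputable def gen (x : Gen E) : FreeAlg k E :=
  MonoidAlgebra.single (FreeSemigroup.of x) 1

/-- The elements that are set to zero in the Leavitt path algebra. In the last relation `v` is a
vertex that emits at least one and at most finitely many edges. -/
inductive Relator : FreeAlg k E → Prop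
  | vert_mul_self (v : E.Vert) :
      Relator (gen k (.vert v) * gen k (.vert v) - gen k (.vert v))
  | vert_mul_vert (v w : E.Vert) (h : v ≠ w) :
      Relator (gen k (.vert v) * gen k (.vert w))
  | src_mul_edge (e : E.Edge) :
      Relator (gen k (.vert (E.src e)) * gen k (.edge e) - gen k (.edge e))
  | edge_mul_rng (e : E.Edge) :
      Relator (gen k (.edge e) * gen k (.vert (E.rng e)) - gen k (.edge e))
  | rng_mul_ghost (e : E.Edge) :
      Relator (gen k (.vert (E.rng e)) * gen k (.ghost e) - gen k (.ghost e))
  | ghost_mul_src (e : E.Edge) :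
      Relator (gen k (.ghost e) * gen k (.vert (E.src e)) - gen k (.ghost e))
  | ghost_mul_self (e : E.Edge) :
      Relator (gen k (.ghost e) * gen k (.edge e) - gen k (.vert (E.rng e)))
  | ghost_mul_edge (e f : E.Edge) (h : e ≠ f) :
      Relator (gen k (.ghost e) * gen k (.edge f))
  | vert_sub_sum (v : E.Vert) (hfin : {e : E.Edge | E.src e = v}.Finite)
      (hne : {e : E.Edge | E.src e = v}.Nonempty) :
      Relator (gen k (.vert v) - ∑ e ∈ hfin.toFinset, gen k (.edge e) * gen k (.ghost e))

/-- The two-sided algebra ideal generated by the relators. In a ring without identity the ideal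
of the ring generated by a set need not be closed under scalars, hence the scalar multiples. -/
noncomputable def relIdeal : TwoSidedIdeal (FreeAlg k E) :=
  TwoSidedIdeal.span {x | ∃ (c : k) (y : FreeAlg k E), Relator k E y ∧ x = c • y}

/-- The Leavitt path algebra `L_k(E)`, an algebra that has an identity only if `E⁰` is finite. -/
def LPA : Type _ := (relIdeal k E).ringCon.Quotient

noncomputable instance : NonUnitalRing (LPA k E) :=
  inferInstanceAs (NonUnitalRing (relIdeal k E).ringCon.Quotient)

/-- The quotient map from the free algebra. -/
noncomputable def LPA.mk : FreeAlg k E →ₙ+* LPA k E where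
  toFun x := (x : (relIdeal k E).ringCon.Quotient)
  map_mul' _ _ := rfl
  map_zero' := rfl
  map_add' _ _ := rfl

variable {k E}

theorem LPA.mk_surjective : Function.Surjective (LPA.mk k E) :=
  Quotient.mk''_surjective

theorem smul_mem_relIdeal (c : k) {x : FreeAlg k E} (hx : x ∈ relIdeal k E) :
    c • x ∈ relIdeal k E := by
  let J : TwoSidedIdeal (FreeAlg k E) := TwoSidedIdeal.mk'
    {x | ∀ c : k, c • x ∈ relIdeal k E}
    (fun c => by simp)
    (fun {x y} hx hy c => by
      rw [smul_add]; exact TwoSidedIdeal.add_mem _ (hx c) (hy c))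
    (fun {x} hx c => by
      rw [smul_neg]; exact TwoSidedIdeal.neg_mem _ (hx c))
    (fun {x y} hy c => by
      rw [← mul_smul_comm]; exact TwoSidedIdeal.mul_mem_left _ _ _ (hy c))
    (fun {x y} hx c => by
      rw [← smul_mul_assoc]; exact TwoSidedIdeal.mul_mem_right _ _ _ (hx c))
  have hJ : relIdeal k E ≤ J := by
    refine TwoSidedIdeal.span_le.2 ?_
    rintro _ ⟨d, y, hy, rfl⟩
    change _ ∈ J
    rw [TwoSidedIdeal.mem_mk']
    intro c
    exact TwoSidedIdeal.subset_span ⟨c * d, y, hy, by rw [mul_smul]⟩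
  have := hJ hx
  rw [TwoSidedIdeal.mem_mk'] at this
  exact this c

noncomputable instance : SMul k (LPA k E) where
  smul c := Quotient.map' (fun x : FreeAlg k E => c • x) fun x y h => by
    have h' : x - y ∈ relIdeal k E := (TwoSidedIdeal.rel_iff _ _ _).1 h
    have := smul_mem_relIdeal c h'
    rw [smul_sub] at this
    exact (TwoSidedIdeal.rel_iff _ _ _).2 this

theorem LPA.mk_smul (c : k) (x : FreeAlg k E) : LPA.mk k E (c • x) = c • LPA.mk k E x := rfl

noncomputable instance : Module k (LPA k E) :=
  Function.Surjective.module k (LPA.mk k E : FreeAlg k E →+ LPA k E) LPA.mk_surjective LPA.mk_smul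

instance : IsScalarTower k (LPA k E) (LPA k E) where
  smul_assoc c x y := by
    obtain ⟨x, rfl⟩ := LPA.mk_surjective x
    obtain ⟨y, rfl⟩ := LPA.mk_surjective y
    simp only [smul_eq_mul, ← LPA.mk_smul, ← map_mul, smul_mul_assoc]

instance : SMulCommClass k (LPA k E) (LPA k E) where
  smul_comm c x y := by
    obtain ⟨x, rfl⟩ := LPA.mk_surjective x
    obtain ⟨y, rfl⟩ := LPA.mk_surjective y
    simp only [smul_eq_mul, ← LPA.mk_smul, ← map_mul, mul_smul_comm]

variable (k E)

/-- The `ℤ`-grading of `L_k(E)`: the component of degree `n` is spanned by the images of the words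
of degree `n`. -/
noncomputable def LPA.grading (n : ℤ) : Submodule k (LPA k E) :=
  Submodule.span k {x | ∃ w : FreeSemigroup (Gen E),
    wordDegree E w = Multiplicative.ofAdd n ∧ x = LPA.mk k E (MonoidAlgebra.single w 1)}

instance : SetLike.GradedMul (LPA.grading k E) where
  mul_mem := by
    intro m n x y hx hy
    refine Submodule.span_induction₂
      (p := fun x y _ _ => x * y ∈ LPA.grading k E (m + n)) ?_ ?_ ?_ ?_ ?_ ?_ ?_ hx hy
    · rintro _ _ ⟨w, hw, rfl⟩ ⟨w', hw', rfl⟩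
      refine Submodule.subset_span ⟨w * w', ?_, ?_⟩
      · rw [map_mul, hw, hw', ofAdd_add]
      · rw [← map_mul, MonoidAlgebra.single_mul_single, one_mul]
    · intro y _; rw [zero_mul]; exact zero_mem _
    · intro x _; rw [mul_zero]; exact zero_mem _
    · intro x y z _ _ _ h h'; rw [add_mul]; exact add_mem h h'
    · intro x y z _ _ _ h h'; rw [mul_add]; exact add_mem h h'
    · intro c x y _ _ h; rw [smul_mul_assoc]; exact Submodule.smul_mem _ _ h
    · intro c x y _ _ h; rw [mul_smul_comm]; exact Submodule.smul_mem _ _ h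

variable {E} in
/-- The vertex `v`, as an element of `L_k(E)`. -/
noncomputable def LPA.vert (v : E.Vert) : LPA k E := LPA.mk k E (gen k (.vert v))

variable {E} in
theorem LPA.vert_mul_self (v : E.Vert) : LPA.vert k v * LPA.vert k v = LPA.vert k v := by
  have h : gen k (.vert v) * gen k (.vert v) - gen k (.vert v) ∈ relIdeal k E :=
    TwoSidedIdeal.subset_span ⟨1, _, Relator.vert_mul_self v, (one_smul k _).symm⟩
  exact Quotient.sound' ((TwoSidedIdeal.rel_iff _ _ _).2 h)

variable {E} in
theorem LPA.vert_mem (v : E.Vert) : LPA.vert k v ∈ LPA.grading k E 0 :=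
  Submodule.subset_span ⟨FreeSemigroup.of (.vert v), by simp [wordDegree, Gen.degree], rfl⟩

end Algebra

/-! ## Idempotent matrices over rings without identity -/

section Blocks

variable {A : Type*} [NonUnitalRing A]

/-- The block diagonal matrix with blocks `x` and `y`. -/
def blockSum {m n m' n' : ℕ} (x : Matrix (Fin m) (Fin n) A) (y : Matrix (Fin m') (Fin n') A) :
    Matrix (Fin (m + m')) (Fin (n + n')) A :=
  (Matrix.fromBlocks x 0 0 y).submatrix finSumFinEquiv.symm finSumFinEquiv.symm

theorem blockSum_mul {l m n l' m' n' : ℕ} (x : Matrix (Fin l) (Fin m) A)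
    (y : Matrix (Fin l') (Fin m') A) (x' : Matrix (Fin m) (Fin n) A)
    (y' : Matrix (Fin m') (Fin n') A) :
    blockSum x y * blockSum x' y' = blockSum (x * x') (y * y') := by
  unfold blockSum
  rw [Matrix.submatrix_mul_equiv, Matrix.fromBlocks_multiply]
  simp

theorem blockSum_apply_mem {S : Type*} [SetLike S A] [AddSubmonoidClass S A] (𝒜 : ℤ → S)
    {m n m' n' : ℕ} {x : Matrix (Fin m) (Fin n) A} {y : Matrix (Fin m') (Fin n') A}
    {c : Fin m → ℤ} {d : Fin n → ℤ} {c' : Fin m' → ℤ} {d' : Fin n' → ℤ}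
    (hx : ∀ i j, x i j ∈ 𝒜 (d j - c i)) (hy : ∀ i j, y i j ∈ 𝒜 (d' j - c' i))
    (i : Fin (m + m')) (j : Fin (n + n')) :
    blockSum x y i j ∈ 𝒜 (Fin.append d d' j - Fin.append c c' i) := by
  refine Fin.addCases (fun i => ?_) (fun i => ?_) i <;>
  refine Fin.addCases (fun j => ?_) (fun j => ?_) j <;>
  simp [blockSum, hx, hy, zero_mem]

theorem blockSum_swap {n n' : ℕ} (x : Matrix (Fin n) (Fin n) A) (y : Matrix (Fin n') (Fin n') A) :
    blockSum y x = (blockSum x y).submatrix finAddFlip finAddFlip := by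
  ext i j
  refine Fin.addCases (fun i => ?_) (fun i => ?_) i <;>
  refine Fin.addCases (fun j => ?_) (fun j => ?_) j <;>
  simp [blockSum]

theorem blockSum_assoc {n n' n'' : ℕ} (x : Matrix (Fin n) (Fin n) A)
    (y : Matrix (Fin n') (Fin n') A) (z : Matrix (Fin n'') (Fin n'') A) :
    blockSum (blockSum x y) z = (blockSum x (blockSum y z)).submatrix
      (finCongr (Nat.add_assoc n n' n'')) (finCongr (Nat.add_assoc n n' n'')) := by
  have h1 (i : Fin n) : finCongr (Nat.add_assoc n n' n'') (Fin.castAdd n'' (Fin.castAdd n' i)) =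
      Fin.castAdd (n' + n'') i := rfl
  have h2 (i : Fin n') : finCongr (Nat.add_assoc n n' n'') (Fin.castAdd n'' (Fin.natAdd n i)) =
      Fin.natAdd n (Fin.castAdd n'' i) := rfl
  have h3 (i : Fin n'') : finCongr (Nat.add_assoc n n' n'') (Fin.natAdd (n + n') i) =
      Fin.natAdd n (Fin.natAdd n' i) := by ext; simp [Nat.add_assoc]
  ext i j
  rw [Matrix.submatrix_apply]
  refine Fin.addCases (fun i => Fin.addCases (fun i => ?_) (fun i => ?_) i) (fun i => ?_) i <;>
  refine Fin.addCases (fun j => Fin.addCases (fun j => ?_) (fun j => ?_) j) (fun j => ?_) j <;>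
  simp only [h1, h2, h3] <;> simp [blockSum]

theorem blockSum_zero {n : ℕ} (x : Matrix (Fin n) (Fin n) A) (y : Matrix (Fin 0) (Fin 0) A) :
    blockSum x y = x := by
  have h (i : Fin n) : (finSumFinEquiv (m := n) (n := 0)).symm i = Sum.inl i :=
    finSumFinEquiv_symm_apply_castAdd i
  ext i j
  unfold blockSum
  rw [Matrix.submatrix_apply, h, h, Matrix.fromBlocks_apply₁₁]

theorem mul_submatrix_id {n m : ℕ} {p : Matrix (Fin n) (Fin n) A} (hp : p * p = p)
    (σ : Fin m ≃ Fin n) :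
    p.submatrix id σ * p.submatrix σ id = p ∧
      p.submatrix σ id * p.submatrix id σ = p.submatrix σ σ := by
  constructor
  · rw [Matrix.submatrix_mul_equiv, hp, Matrix.submatrix_id_id]
  · have := Matrix.submatrix_mul p p σ (id : Fin n → Fin n) σ Function.bijective_id
    rw [← this, hp]

end Blocks

/-! ## The monoid `V(A)` and the group `K₀(A)` -/

section Ungraded

/-- An idempotent square matrix over `A`. -/
structure IdemMat (A : Type*) [NonUnitalRing A] where
  /-- the size -/
  size : ℕ
  /-- the matrix -/
  mat : Matrix (Fin size) (Fin size) A
  mul_self : mat * mat = mat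

variable {A : Type*} [NonUnitalRing A]

/-- Equivalence of idempotent matrices: `p = x y` and `q = y x` for some matrices `x`, `y`.
For a ring with identity this says that the projective modules `Aⁿ p` and `Aᵐ q` are isomorphic. -/
def IdemMat.Equivalent (P Q : IdemMat A) : Prop :=
  ∃ (x : Matrix (Fin P.size) (Fin Q.size) A) (y : Matrix (Fin Q.size) (Fin P.size) A),
    x * y = P.mat ∧ y * x = Q.mat

theorem mul_trans_aux {l m n : ℕ} {p : Matrix (Fin l) (Fin l) A} {q : Matrix (Fin m) (Fin m) A}
    {r : Matrix (Fin n) (Fin n) A} {x : Matrix (Fin l) (Fin m) A} {y : Matrix (Fin m) (Fin l) A}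
    {z : Matrix (Fin m) (Fin n) A} {w : Matrix (Fin n) (Fin m) A} (hp : p * p = p)
    (hr : r * r = r) (h1 : x * y = p) (h2 : y * x = q) (h3 : z * w = q) (h4 : w * z = r) :
    (x * z) * (w * y) = p ∧ (w * y) * (x * z) = r := by
  constructor
  · calc (x * z) * (w * y) = x * (z * w) * y := by simp only [Matrix.mul_assoc]
      _ = (x * y) * (x * y) := by rw [h3, ← h2]; simp only [Matrix.mul_assoc]
      _ = p := by rw [h1, hp]
  · calc (w * y) * (x * z) = w * (y * x) * z := by simp only [Matrix.mul_assoc]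
      _ = (w * z) * (w * z) := by rw [h2, ← h3]; simp only [Matrix.mul_assoc]
      _ = r := by rw [h4, hr]

instance IdemMat.setoid (A : Type*) [NonUnitalRing A] : Setoid (IdemMat A) where
  r := IdemMat.Equivalent
  iseqv :=
    { refl := fun P => ⟨P.mat, P.mat, P.mul_self, P.mul_self⟩
      symm := fun ⟨x, y, h, h'⟩ => ⟨y, x, h', h⟩
      trans := fun {P _ R} ⟨_, _, h1, h2⟩ ⟨_, _, h3, h4⟩ =>
        ⟨_, _, mul_trans_aux P.mul_self R.mul_self h1 h2 h3 h4⟩ }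

/-- The direct sum of two idempotent matrices. -/
def IdemMat.sum (P Q : IdemMat A) : IdemMat A where
  size := P.size + Q.size
  mat := blockSum P.mat Q.mat
  mul_self := by rw [blockSum_mul, P.mul_self, Q.mul_self]

theorem IdemMat.equivalent_of_submatrix (P Q : IdemMat A) (σ : Fin Q.size ≃ Fin P.size)
    (h : Q.mat = P.mat.submatrix σ σ) : P ≈ Q :=
  ⟨_, _, (mul_submatrix_id P.mul_self σ).1, (mul_submatrix_id P.mul_self σ).2.trans h.symm⟩

/-- The monoid `V(A)` of equivalence classes of idempotent matrices over `A`. -/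
def VMon (A : Type*) [NonUnitalRing A] : Type _ := Quotient (IdemMat.setoid A)

instance : Zero (VMon A) := ⟨Quotient.mk _ ⟨0, 0, by simp⟩⟩

instance : Add (VMon A) :=
  ⟨Quotient.map₂ IdemMat.sum fun _ _ ⟨x, y, h1, h2⟩ _ _ ⟨z, w, h3, h4⟩ =>
    ⟨blockSum x z, blockSum y w, (blockSum_mul x z y w).trans (congrArg₂ blockSum h1 h3),
      (blockSum_mul y w x z).trans (congrArg₂ blockSum h2 h4)⟩⟩

theorem VMon.add_comm' (a b : VMon A) : a + b = b + a := by
  induction a, b using Quotient.inductionOn₂ with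
  | _ P Q =>
    exact Quotient.sound
      (IdemMat.equivalent_of_submatrix (P.sum Q) (Q.sum P) finAddFlip (blockSum_swap P.mat Q.mat))

theorem VMon.add_zero' (a : VMon A) : a + 0 = a := by
  induction a using Quotient.inductionOn with
  | _ P =>
    exact Quotient.sound
      (IdemMat.equivalent_of_submatrix (P.sum ⟨0, 0, by simp⟩) P (Equiv.refl _)
        (blockSum_zero P.mat 0).symm)

theorem VMon.add_assoc' (a b c : VMon A) : a + b + c = a + (b + c) := by
  induction a, b, c using Quotient.inductionOn₃ with
  | _ P Q R =>
    exact (Quotient.sound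
      (IdemMat.equivalent_of_submatrix (P.sum (Q.sum R)) ((P.sum Q).sum R)
        (finCongr (Nat.add_assoc _ _ _)) (blockSum_assoc P.mat Q.mat R.mat))).symm

instance : AddCommMonoid (VMon A) where
  add_assoc := VMon.add_assoc'
  zero_add a := (VMon.add_comm' 0 a).trans (VMon.add_zero' a)
  add_zero := VMon.add_zero'
  add_comm := VMon.add_comm'
  nsmul := nsmulRec

/-- The Grothendieck group `K₀(A)`, the group completion of `V(A)`. (This is the standard `K₀` for
rings with local units, such as Leavitt path algebras.) -/
abbrev K0 (A : Type*) [NonUnitalRing A] : Type _ := Algebra.GrothendieckAddGroup (VMon A)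

end Ungraded

/-! ## The monoid `V^gr(A)` and the group `K₀^gr(A)` -/

section Graded

/-- A graded idempotent matrix over a `ℤ`-graded ring `A = ⨁ₙ 𝒜 n`: shifts `d₁, …, dₙ` and an
idempotent matrix `p` with `pᵢⱼ` homogeneous of degree `dⱼ - dᵢ`. Such a `p` acts by right
multiplication on the rows in `A(d₁) ⊕ ⋯ ⊕ A(dₙ)` as an endomorphism of degree zero; here `A(d)` is
`A` with the grading `A(d)ₘ = 𝒜 (m + d)`. So `p` stands for the graded projective left module
`(A(d₁) ⊕ ⋯ ⊕ A(dₙ)) p`. -/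
structure GrIdemMat {A : Type*} [NonUnitalRing A] {S : Type*} [SetLike S A] (𝒜 : ℤ → S)
    extends IdemMat A where
  /-- the shifts -/
  shift : Fin size → ℤ
  mem : ∀ i j, mat i j ∈ 𝒜 (shift j - shift i)

variable {A : Type*} [NonUnitalRing A] {S : Type*} [SetLike S A]
variable {𝒜 : ℤ → S}

/-- Graded equivalence of graded idempotent matrices: `p = x y` and `q = y x` for some matrices
`x`, `y` that act as homomorphisms of degree zero between the shifted free modules. -/
def GrIdemMat.Equivalent (P Q : GrIdemMat 𝒜) : Prop :=
  ∃ (x : Matrix (Fin P.size) (Fin Q.size) A) (y : Matrix (Fin Q.size) (Fin P.size) A),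
    (∀ i j, x i j ∈ 𝒜 (Q.shift j - P.shift i)) ∧ (∀ i j, y i j ∈ 𝒜 (P.shift j - Q.shift i)) ∧
      x * y = P.mat ∧ y * x = Q.mat

theorem GrIdemMat.equivalent_of_submatrix (P Q : GrIdemMat 𝒜) (σ : Fin Q.size ≃ Fin P.size)
    (h : Q.mat = P.mat.submatrix σ σ) (hs : ∀ i, Q.shift i = P.shift (σ i)) :
    P.Equivalent Q :=
  ⟨P.mat.submatrix id σ, P.mat.submatrix σ id, fun i j => by rw [hs]; exact P.mem _ _,
    fun i j => by rw [hs]; exact P.mem _ _, (mul_submatrix_id P.mul_self σ).1,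
    (mul_submatrix_id P.mul_self σ).2.trans h.symm⟩

variable [AddSubmonoidClass S A]

theorem mul_apply_mem [SetLike.GradedMul 𝒜] {l m n : ℕ} {x : Matrix (Fin l) (Fin m) A}
    {y : Matrix (Fin m) (Fin n) A} {c : Fin l → ℤ} {d : Fin m → ℤ} {e : Fin n → ℤ}
    (hx : ∀ i j, x i j ∈ 𝒜 (d j - c i)) (hy : ∀ i j, y i j ∈ 𝒜 (e j - d i))
    (i : Fin l) (j : Fin n) : (x * y) i j ∈ 𝒜 (e j - c i) := by
  rw [Matrix.mul_apply]
  refine sum_mem fun a _ => ?_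
  have := SetLike.mul_mem_graded (hx i a) (hy a j)
  rwa [add_comm, sub_add_sub_cancel] at this

/-- The direct sum of two graded idempotent matrices. -/
def GrIdemMat.sum (P Q : GrIdemMat 𝒜) : GrIdemMat 𝒜 where
  toIdemMat := P.toIdemMat.sum Q.toIdemMat
  shift := Fin.append P.shift Q.shift
  mem := blockSum_apply_mem 𝒜 P.mem Q.mem

/-- The empty matrix. -/
def GrIdemMat.empty (𝒜 : ℤ → S) : GrIdemMat 𝒜 where
  toIdemMat := ⟨0, 0, by simp⟩
  shift := Fin.elim0
  mem i := i.elim0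

variable [SetLike.GradedMul 𝒜]

instance GrIdemMat.setoid (𝒜 : ℤ → S) [SetLike.GradedMul 𝒜] : Setoid (GrIdemMat 𝒜) where
  r := GrIdemMat.Equivalent
  iseqv :=
    { refl := fun P => ⟨P.mat, P.mat, P.mem, P.mem, P.mul_self, P.mul_self⟩
      symm := fun ⟨x, y, hx, hy, h, h'⟩ => ⟨y, x, hy, hx, h', h⟩
      trans := fun {P _ R} ⟨_, _, hx, hy, h1, h2⟩ ⟨_, _, hz, hw, h3, h4⟩ =>
        ⟨_, _, mul_apply_mem hx hz, mul_apply_mem hw hy,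
          mul_trans_aux P.mul_self R.mul_self h1 h2 h3 h4⟩ }

/-- The monoid `V^gr(A)` of graded equivalence classes of graded idempotent matrices over `A`. -/
def VGr (𝒜 : ℤ → S) [SetLike.GradedMul 𝒜] : Type _ := Quotient (GrIdemMat.setoid 𝒜)

/-- The class of a graded idempotent matrix. -/
def VGr.mk (P : GrIdemMat 𝒜) : VGr 𝒜 := Quotient.mk _ P

instance : Zero (VGr 𝒜) := ⟨VGr.mk (GrIdemMat.empty 𝒜)⟩

instance : Add (VGr 𝒜) :=
  ⟨Quotient.map₂ GrIdemMat.sum fun _ _ ⟨x, y, hx, hy, h1, h2⟩ _ _ ⟨z, w, hz, hw, h3, h4⟩ =>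
    ⟨blockSum x z, blockSum y w, blockSum_apply_mem 𝒜 hx hz, blockSum_apply_mem 𝒜 hy hw,
      (blockSum_mul x z y w).trans (congrArg₂ blockSum h1 h3),
      (blockSum_mul y w x z).trans (congrArg₂ blockSum h2 h4)⟩⟩

theorem VGr.add_comm' (a b : VGr 𝒜) : a + b = b + a := by
  induction a, b using Quotient.inductionOn₂ with
  | _ P Q =>
    exact Quotient.sound
      (GrIdemMat.equivalent_of_submatrix (P.sum Q) (Q.sum P) finAddFlip
        (blockSum_swap P.mat Q.mat) fun i =>
          Fin.addCases
            (motive := fun i => Fin.append Q.shift P.shift i =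
              Fin.append P.shift Q.shift (finAddFlip i))
            (fun i => by simp) (fun i => by simp) i)

theorem VGr.add_zero' (a : VGr 𝒜) : a + 0 = a := by
  induction a using Quotient.inductionOn with
  | _ P =>
    exact Quotient.sound
      (GrIdemMat.equivalent_of_submatrix (P.sum (GrIdemMat.empty 𝒜)) P (Equiv.refl _)
        (blockSum_zero P.mat 0).symm fun i =>
          (Fin.append_left P.shift Fin.elim0 i).symm)

theorem VGr.add_assoc' (a b c : VGr 𝒜) : a + b + c = a + (b + c) := by
  induction a, b, c using Quotient.inductionOn₃ with
  | _ P Q R =>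
    exact (Quotient.sound
      (GrIdemMat.equivalent_of_submatrix (P.sum (Q.sum R)) ((P.sum Q).sum R)
        (finCongr (Nat.add_assoc _ _ _)) (blockSum_assoc P.mat Q.mat R.mat)
          fun i => congrFun (Fin.append_assoc P.shift Q.shift R.shift) i)).symm

instance : AddCommMonoid (VGr 𝒜) where
  add_assoc := VGr.add_assoc'
  zero_add a := (VGr.add_comm' 0 a).trans (VGr.add_zero' a)
  add_zero := VGr.add_zero'
  add_comm := VGr.add_comm'
  nsmul := nsmulRec

/-- The graded Grothendieck group `K₀^gr(A)`, the group completion of `V^gr(A)`. -/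
abbrev K0Gr (𝒜 : ℤ → S) [SetLike.GradedMul 𝒜] : Type _ := Algebra.GrothendieckAddGroup (VGr 𝒜)

/-- The homomorphism `V^gr(A) → V(A)` that forgets the grading. -/
def VGr.forget (𝒜 : ℤ → S) [SetLike.GradedMul 𝒜] : VGr 𝒜 →+ VMon A where
  toFun := Quotient.map (fun P => P.toIdemMat) fun _ _ ⟨x, y, _, _, h, h'⟩ => ⟨x, y, h, h'⟩
  map_zero' := rfl
  map_add' a b := by
    induction a, b using Quotient.inductionOn₂ with
    | _ P Q => rfl

/-- The homomorphism `U : K₀^gr(A) → K₀(A)` induced by forgetting the grading. -/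
noncomputable def forgetHom (𝒜 : ℤ → S) [SetLike.GradedMul 𝒜] : K0Gr 𝒜 →+ K0 A :=
  Algebra.GrothendieckAddGroup.lift (Algebra.GrothendieckAddGroup.of.comp (VGr.forget 𝒜))

end Graded

/-! ## The classes of the vertices -/

section Vertices

variable (k : Type*) [Field k] {E : DirGraph}

/-- The `1 × 1` matrix `v` with shift `-i`, which stands for the graded module `(L(E) v)(-i)`. -/
noncomputable def vertIdem (v : E.Vert) (i : ℤ) : GrIdemMat (LPA.grading k E) where
  size := 1
  mat := Matrix.of fun _ _ => LPA.vert k v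
  mul_self := by
    ext a b
    rw [Matrix.mul_apply, Fin.sum_univ_one]
    exact LPA.vert_mul_self k v
  shift := fun _ => -i
  mem _ _ := by rw [sub_self]; exact LPA.vert_mem k v

/-- The element `v(i) = [(L(E) v)(-i)]` of `K₀^gr(L(E))`. -/
noncomputable def vertClass (v : E.Vert) (i : ℤ) : K0Gr (LPA.grading k E) :=
  Algebra.GrothendieckAddGroup.of (VGr.mk (vertIdem k v i))

end Vertices

end Leavitt

/-! Two facts carry the theorem. Every idempotent matrix over $L(E)$, graded or not, is equivalent
to a diagonal matrix of vertices (`exists_diagonal`). If two such diagonal matrices are equivalent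
over $L(E)$, their vertices have equal sums under every map $h$ from $E^0$ to an abelian group with
$h(v)=\sum_{s(e)=v}h(r(e))$ at each non-sink (`sum_eq_of_equivalent_diagonal`).

Given these, surjectivity of $U$ is clear, since a vertex can be given any shift. For the kernel,
divide $K_0^{\rm gr}$ by the image of $\phi$. There $v(i)$ no longer depends on $i$, so the graded
relation $v(i)=\sum r(e)(i-1)$ makes $h(v)=[v(0)]$ a map as above. An element killed by $U$ is a
difference of two diagonal classes that become equivalent, after adding a third, without the
grading. The second fact then shows that it vanishes in the quotient.

Both facts come from the path algebra formed by the ghost edges. The ghost paths are linearly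
independent in $L(E)$ (`exists_dual_ghostPath`, by a representation on functions). Every element of
$L(E)$ is carried into their span by all sufficiently long ghost paths and by those that end at a
sink (the filtration `level`). So rows over $L(E)$ contain lattices, free over the path algebra, on
which edges act by left multiplication with ghost edges. A Schreier argument (`Sub.exists_basis`)
shows that a graded submodule of a free module is free: a maximal tree of paths independent modulo
the submodule is a transversal, and the paths just outside the tree index the generators.

For the first fact, apply this to the intersection of the row space of $p$ with the standard
lattice. The resulting generators also form a basis of the row space over $L(E)$, and each of them
spans a copy of some $L(E)v$.

For the second, an equivalence gives two lattices in one module, each expressed through the other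
with coefficients in $L(E)$. Relative to either lattice the intersection has a finite transversal
that avoids sinks. Growing such a tree replaces a vertex by the ranges of its edges, so the sum of
$h$ over the boundary equals the sum over the roots. The number of boundary elements at a vertex is
the dimension of the intersection there modulo the images of the edges, which does not depend on the
lattice (`finrank_quotient_act`). Hence the two sums agree. -/

/-! ## Paths -/

namespace DirGraph

variable {E : DirGraph}

/-- The end of the path that starts at `u` and has the edges of a list, in reversed order. -/
def tip (u : E.Vert) : List E.Edge → E.Vert
  | [] => u
  | e :: _ => E.rng e

/-- The reversed list of edges is a path that starts at `u`. -/
def IsPath (u : E.Vert) : List E.Edge → Prop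
  | [] => True
  | e :: l => E.src e = tip u l ∧ IsPath u l

/-- The vertex emits no edges. -/
def IsSink (v : E.Vert) : Prop := ∀ e : E.Edge, E.src e ≠ v

end DirGraph

namespace Leavitt

open DirGraph Submodule

/-! ### Linear independence: triangular changes and quotients -/

section LinearAlgebra

variable {k M ι : Type*} [Field k] [AddCommGroup M] [Module k M]

/-- A unitriangular change of a linearly independent family is linearly independent. -/
theorem linearIndepOn_of_triangular {b b' : ι → M} {S : Set ι} (r : ι → ℕ)
    (hb : LinearIndepOn k b S)
    (h : ∀ i ∈ S, b' i - b i ∈ span k (b '' {j | j ∈ S ∧ r j < r i})) :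
    LinearIndepOn k b' S := by
  classical
  rw [linearIndepOn_iff']
  intro t c hts hsum
  by_contra! hne
  obtain ⟨i₁, hi₁, hci₁⟩ := hne
  -- At an index `i` of maximal rank among the nonzero coefficients, `b i` enters the relation only
  -- through the term of `i`: the corrections of the other terms have rank less than that of `i`.
  obtain ⟨i, hi, hmax⟩ := Finset.exists_max_image (t.filter fun i => c i ≠ 0) r
    ⟨i₁, Finset.mem_filter.2 ⟨hi₁, hci₁⟩⟩
  obtain ⟨hit, hci⟩ := Finset.mem_filter.1 hi
  have hnot : b i ∉ span k (b '' (S \ {i})) := by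
    have := (linearIndepOn_insert (K := k) (f := b) (s := S \ {i}) (a := i) (by simp)).1
      (by rwa [Set.insert_sdiff_singleton, Set.insert_eq_of_mem (hts hit)])
    exact this.2
  have hsub : ∀ j ∈ t, c j ≠ 0 → b' j - b j ∈ span k (b '' (S \ {i})) := by
    intro j hj hcj
    refine span_mono (Set.image_mono ?_) (h j (hts hj))
    rintro l ⟨hl, hlr⟩
    refine ⟨hl, ?_⟩
    rintro rfl
    exact absurd (hmax j (Finset.mem_filter.2 ⟨hj, hcj⟩)) (not_le.2 hlr)
  apply hnot
  have key : c i • b i ∈ span k (b '' (S \ {i})) := by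
    have e : c i • b i = -(c i • (b' i - b i) + ∑ j ∈ t.erase i, c j • b' j) := by
      rw [← Finset.add_sum_erase t _ hit] at hsum
      rw [smul_sub, eq_neg_iff_add_eq_zero, ← hsum]
      abel
    rw [e]
    refine neg_mem (add_mem (smul_mem _ _ (hsub i hit hci)) (sum_mem fun j hj => ?_))
    obtain ⟨hji, hjt⟩ := Finset.mem_erase.1 hj
    by_cases hcj : c j = 0
    · rw [hcj, zero_smul]; exact zero_mem _
    · have : b' j = (b' j - b j) + b j := by abel
      rw [this]
      exact smul_mem _ _ (add_mem (hsub j hjt hcj) (subset_span ⟨j, ⟨hts hjt, hji⟩, rfl⟩))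
  have := smul_mem _ (c i)⁻¹ key
  rwa [inv_smul_smul₀ hci] at this

theorem eq_zero_of_mem_span_of_linearIndepOn_mkQ {b : ι → M} {S : Set ι} {N : Submodule k M}
    (hb : LinearIndepOn k (N.mkQ ∘ b) S) {s : M} (hs : s ∈ span k (b '' S)) (hN : s ∈ N) :
    s = 0 := by
  obtain ⟨c, hc, rfl⟩ := (Finsupp.mem_span_image_iff_linearCombination k).1 hs
  have : c = 0 := by
    refine linearIndepOn_iff.1 hb c hc ?_
    have h : N.mkQ (Finsupp.linearCombination k b c) = 0 := by simpa using hN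
    rwa [Finsupp.apply_linearCombination] at h
  rw [this, map_zero]

end LinearAlgebra

/-! ## Free modules over the path algebra and their submodules -/

section PathModule

variable {k M : Type*} [Field k] [AddCommGroup M] [Module k M] {E : DirGraph} {X : Type*}

/-- A free module over the path algebra of `E`, in a space on which the edges act by `act`. Its
generators are indexed by `X`, and its basis consists of the paths that start at the vertices of
the generators. The degree of a path of length `n` is `n * step` plus the degree of the
generator. -/
structure PathModule (act : E.Edge → M →ₗ[k] M) (X : Type*) where
  /-- the vertex of a generator -/
  root : X → E.Vert
  /-- the degree of a generator -/
  deg : X → ℤ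
  /-- the degree of an edge -/
  step : ℤ
  /-- the basis element of a path -/
  word : X × List E.Edge → M
  linearIndep : LinearIndepOn k word {m | IsPath (root m.1) m.2}
  act_word : ∀ x e l, IsPath (root x) (e :: l) → act e (word (x, l)) = word (x, e :: l)

namespace PathModule

variable {act : E.Edge → M →ₗ[k] M} (P : PathModule act X)

/-- The paths that start at the vertices of the generators. -/
def paths : Set (X × List E.Edge) := {m | IsPath (P.root m.1) m.2}

/-- The degree and the end of a path. -/
def cls (m : X × List E.Edge) : ℤ × E.Vert :=
  (P.deg m.1 + P.step * m.2.length, tip (P.root m.1) m.2)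

/-- The homogeneous components. -/
def comp (c : ℤ × E.Vert) : Submodule k M := span k (P.word '' {m | m ∈ P.paths ∧ P.cls m = c})

/-- A graded submodule, given by its homogeneous components. -/
structure Sub where
  /-- the homogeneous components -/
  carrier : ℤ × E.Vert → Submodule k M
  le_comp : ∀ c, carrier c ≤ P.comp c
  act_mem : ∀ e d r, r ∈ carrier (d, E.src e) → act e r ∈ carrier (d + P.step, E.rng e)

variable {P}

/-- A set of paths, closed under passing to initial segments, whose members of each degree and end
are linearly independent modulo the submodule. -/
structure Sub.IsTransversal (N : P.Sub) (T : Set (X × List E.Edge)) : Prop where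
  subset : T ⊆ P.paths
  tail : ∀ x e l, (x, e :: l) ∈ T → (x, l) ∈ T
  indep : ∀ c, LinearIndepOn k ((N.carrier c).mkQ ∘ P.word) {m | m ∈ T ∧ P.cls m = c}

/-- The paths outside `T` whose proper initial segments belong to `T`. -/
def boundary (P : PathModule act X) (T : Set (X × List E.Edge)) : Set (X × List E.Edge) :=
  {m | m ∈ P.paths ∧ m ∉ T ∧ ∀ e l, m.2 = e :: l → (m.1, l) ∈ T}

theorem Sub.exists_maximal_isTransversal (N : P.Sub) :
    ∃ T, Maximal N.IsTransversal T := by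
  refine zorn_subset {T | N.IsTransversal T} fun C hC hchain => ?_
  refine ⟨⋃₀ C, ⟨?_, ?_, ?_⟩, fun s hs => Set.subset_sUnion_of_mem hs⟩
  · exact Set.sUnion_subset fun s hs => (hC hs).subset
  · rintro x e l ⟨s, hs, h⟩
    exact ⟨s, hs, (hC hs).tail x e l h⟩
  · intro c
    have : {m | m ∈ ⋃₀ C ∧ P.cls m = c} = ⋃ s ∈ C, {m | m ∈ s ∧ P.cls m = c} := by
      ext m; simp only [Set.mem_sUnion, Set.mem_ofPred_eq, Set.mem_iUnion]; tauto
    rw [this]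
    refine linearIndepOn_biUnion_of_directed ?_ fun s hs => (hC hs).indep c
    intro s hs t ht
    obtain h | h := hchain.total hs ht
    · exact ⟨t, ht, fun m hm => ⟨h hm.1, hm.2⟩, subset_rfl⟩
    · exact ⟨s, hs, subset_rfl, fun m hm => ⟨h hm.1, hm.2⟩⟩

/-- Adding a boundary path to `T` keeps it closed under initial segments. By maximality independence
must fail, so modulo the submodule the path is a combination of members of `T` of the same class.
The difference is the required element. -/
theorem Sub.exists_boundary_element (N : P.Sub) {T : Set (X × List E.Edge)}
    (hT : Maximal N.IsTransversal T) {m : X × List E.Edge} (hm : m ∈ P.boundary T) :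
    ∃ f ∈ N.carrier (P.cls m),
      f - P.word m ∈ span k (P.word '' {t | t ∈ T ∧ P.cls t = P.cls m}) := by
  obtain ⟨hmp, hmT, hmt⟩ := hm
  have hnot : ¬ N.IsTransversal (insert m T) := fun h =>
    hmT (hT.2 h (Set.subset_insert m T) (Set.mem_insert m T))
  have hspan : (N.carrier (P.cls m)).mkQ (P.word m) ∈
      span k (((N.carrier (P.cls m)).mkQ ∘ P.word) '' {t | t ∈ T ∧ P.cls t = P.cls m}) := by
    by_contra hcon
    refine hnot ⟨Set.insert_subset hmp hT.1.subset, ?_, fun c => ?_⟩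
    · rintro x e l (h | h)
      · subst h
        exact Or.inr (hmt e l rfl)
      · exact Or.inr (hT.1.tail x e l h)
    · by_cases hc : P.cls m = c
      · subst hc
        have : {t | t ∈ insert m T ∧ P.cls t = P.cls m} =
            insert m {t | t ∈ T ∧ P.cls t = P.cls m} := by
          ext t
          simp only [Set.mem_insert_iff, Set.mem_ofPred_eq]
          constructor
          · rintro ⟨h | h, h'⟩
            · exact Or.inl h
            · exact Or.inr ⟨h, h'⟩
          · rintro (h | h)
            · exact ⟨Or.inl h, by rw [h]⟩
            · exact ⟨Or.inr h.1, h.2⟩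
        rw [this, linearIndepOn_insert (fun h => hmT h.1)]
        exact ⟨hT.1.indep _, hcon⟩
      · have : {t | t ∈ insert m T ∧ P.cls t = c} = {t | t ∈ T ∧ P.cls t = c} := by
          ext t
          simp only [Set.mem_insert_iff, Set.mem_ofPred_eq]
          constructor
          · rintro ⟨rfl | h, h'⟩
            · exact absurd h' hc
            · exact ⟨h, h'⟩
          · exact fun h => ⟨Or.inr h.1, h.2⟩
        rw [this]
        exact hT.1.indep c
  rw [Set.image_comp, ← Submodule.map_span] at hspan
  obtain ⟨s, hs, hsm⟩ := hspan
  refine ⟨P.word m - s, ?_, by rw [sub_sub_cancel_left]; exact neg_mem hs⟩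
  rw [← Submodule.ker_mkQ (N.carrier (P.cls m)), LinearMap.mem_ker, map_sub, hsm, sub_self]

open Classical in
/-- The basis that continues the boundary elements `f` by the action of the edges. -/
noncomputable def basisOf (P : PathModule act X) (T : Set (X × List E.Edge))
    (f : X × List E.Edge → M) (x : X) : List E.Edge → M
  | [] => if (x, []) ∈ T then P.word (x, []) else f (x, [])
  | e :: l => if (x, e :: l) ∈ T then P.word (x, e :: l) else
      if (x, l) ∈ T then f (x, e :: l) else act e (basisOf P T f x l)

open Classical in
/-- The number of edges by which a path leaves `T`. -/
noncomputable def excess (T : Set (X × List E.Edge)) (x : X) : List E.Edge → ℕ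
  | [] => if (x, []) ∈ T then 0 else 1
  | e :: l => if (x, e :: l) ∈ T then 0 else excess T x l + 1

theorem excess_eq_zero {T : Set (X × List E.Edge)} {x : X} {l : List E.Edge} (h : (x, l) ∈ T) :
    excess T x l = 0 := by
  cases l <;> simp [excess, h]

theorem cls_cons (x : X) (e : E.Edge) (l : List E.Edge) :
    P.cls (x, e :: l) = ((P.cls (x, l)).1 + P.step, E.rng e) := by
  simp only [cls, tip, List.length_cons]
  push_cast
  congr 1
  ring

/-- The sets `S` and `S'` carry a side condition on paths through the action of an edge. In
`basisOf_sub_word` it is a bound on the excess. -/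
theorem act_mem_span_word {e : E.Edge} {c : ℤ × E.Vert} {S S' : Set (X × List E.Edge)}
    (hc : c.2 = E.src e)
    (h : ∀ x l, (x, l) ∈ S → P.cls (x, l) = c → (x, e :: l) ∈ S') {r : M}
    (hr : r ∈ span k (P.word '' {m | m ∈ P.paths ∧ P.cls m = c ∧ m ∈ S})) :
    act e r ∈ span k (P.word '' {m | m ∈ P.paths ∧ P.cls m = (c.1 + P.step, E.rng e) ∧ m ∈ S'}) := by
  induction hr using Submodule.span_induction with
  | mem r hr =>
    obtain ⟨⟨x, l⟩, ⟨hp, hcl, hS⟩, rfl⟩ := hr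
    have hpath : IsPath (P.root x) (e :: l) := by
      refine ⟨?_, hp⟩
      rw [← hc, ← hcl]; rfl
    rw [P.act_word x e l hpath]
    exact subset_span ⟨_, ⟨hpath, by rw [cls_cons, hcl], h x l hS hcl⟩, rfl⟩
  | zero => rw [map_zero]; exact zero_mem _
  | add x y _ _ hx hy => rw [map_add]; exact add_mem hx hy
  | smul a x _ hx => rw [map_smul]; exact smul_mem _ _ hx

theorem boundary_of_nil {T : Set (X × List E.Edge)} {x : X} (h : (x, []) ∉ T) :
    (x, []) ∈ P.boundary T :=
  ⟨trivial, h, fun e l h => by simp at h⟩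

theorem boundary_of_cons {T : Set (X × List E.Edge)} {x : X} {e : E.Edge} {l : List E.Edge}
    (hp : (x, e :: l) ∈ P.paths) (h : (x, e :: l) ∉ T) (h' : (x, l) ∈ T) :
    (x, e :: l) ∈ P.boundary T :=
  ⟨hp, h, fun e' l' h => by simp only [List.cons.injEq] at h; rw [← h.2]; exact h'⟩

variable {T : Set (X × List E.Edge)} {f : X × List E.Edge → M}

/-- The new family is unitriangular with respect to the excess. At the boundary the correction lies
in the span of `T`, where the excess is zero; each further edge raises the excess of the path by one
and that of the correction terms by at most one. -/
theorem basisOf_sub_word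
    (hf : ∀ m ∈ P.boundary T,
      f m - P.word m ∈ span k (P.word '' {t | t ∈ P.paths ∧ P.cls t = P.cls m ∧ t ∈ T}))
    (x : X) (l : List E.Edge) (hp : (x, l) ∈ P.paths) :
    P.basisOf T f x l - P.word (x, l) ∈ span k (P.word ''
      {m | m ∈ P.paths ∧ P.cls m = P.cls (x, l) ∧ excess T m.1 m.2 < excess T x l}) := by
  have hb (m : X × List E.Edge) (hm : m ∈ P.boundary T) (n : ℕ) (hn : 0 < n) :
      f m - P.word m ∈ span k (P.word ''
        {y | y ∈ P.paths ∧ P.cls y = P.cls m ∧ excess T y.1 y.2 < n}) := by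
    refine span_mono (Set.image_mono ?_) (hf m hm)
    rintro t ⟨h1, h2, h3⟩
    exact ⟨h1, h2, by rw [excess_eq_zero h3]; exact hn⟩
  induction l with
  | nil =>
    by_cases h : (x, []) ∈ T
    · simp [basisOf, h]
    · simpa [basisOf, h, excess] using hb _ (boundary_of_nil h) 1 one_pos
  | cons e l ih =>
    by_cases h : (x, e :: l) ∈ T
    · simp [basisOf, h]
    by_cases h' : (x, l) ∈ T
    · simpa [basisOf, h, h', excess] using
        hb _ (boundary_of_cons hp h h') (excess T x l + 1) (Nat.succ_pos _)
    · have := act_mem_span_word (e := e) (c := P.cls (x, l))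
        (S := {m | excess T m.1 m.2 < excess T x l})
        (S' := {m | excess T m.1 m.2 < excess T x l + 1}) hp.1.symm ?_ (ih hp.2)
      · rw [map_sub, P.act_word x e l hp] at this
        rw [cls_cons]
        simpa [basisOf, h, h', excess] using this
      · intro y l' hy _
        simp only [excess, Set.mem_ofPred_eq] at hy ⊢
        split_ifs <;> omega

/-- Inversion of the triangular change, by induction on the excess; with `basisOf_sub_word` it makes
`basisOf` a basis in each class. -/
theorem word_mem_span_basisOf
    (hf : ∀ m ∈ P.boundary T,
      f m - P.word m ∈ span k (P.word '' {t | t ∈ P.paths ∧ P.cls t = P.cls m ∧ t ∈ T}))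
    (n : ℕ) : ∀ (x : X) (l : List E.Edge), (x, l) ∈ P.paths → excess T x l < n →
    P.word (x, l) ∈ span k ((fun m => P.basisOf T f m.1 m.2) ''
      {m | m ∈ P.paths ∧ P.cls m = P.cls (x, l)}) := by
  induction n with
  | zero => intro x l _ h; omega
  | succ n ih =>
    intro x l hp hn
    have h1 := basisOf_sub_word hf x l hp
    rw [← sub_sub_cancel (P.basisOf T f x l) (P.word (x, l))]
    refine sub_mem (subset_span ⟨(x, l), ⟨hp, rfl⟩, rfl⟩) ?_
    refine span_le.2 ?_ h1
    rintro _ ⟨⟨y, l'⟩, ⟨hy, hcl, hex⟩, rfl⟩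
    have := ih y l' hy (by simp only at hex; omega)
    rwa [hcl] at this

/-- **The Schreier theorem**: a submodule of a free module over the path algebra is free on the
boundary of a Schreier transversal. -/
theorem Sub.exists_basis (N : P.Sub) : ∃ (T : Set (X × List E.Edge)) (b : X × List E.Edge → M),
    T ⊆ P.paths ∧ (∀ x e l, (x, e :: l) ∈ T → (x, l) ∈ T) ∧
    (∀ t ∈ T, P.word t ∉ N.carrier (P.cls t)) ∧
    LinearIndepOn k b P.paths ∧
    (∀ x e l, (x, e :: l) ∈ P.paths → (x, l) ∉ T → b (x, e :: l) = act e (b (x, l))) ∧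
    (∀ c, N.carrier c = span k (b '' {m | m ∈ P.paths ∧ m ∉ T ∧ P.cls m = c})) := by
  classical
  obtain ⟨T, hT⟩ := N.exists_maximal_isTransversal
  have hex (m : X × List E.Edge) : ∃ f : M, m ∈ P.boundary T → f ∈ N.carrier (P.cls m) ∧
      f - P.word m ∈ span k (P.word '' {t | t ∈ P.paths ∧ P.cls t = P.cls m ∧ t ∈ T}) := by
    by_cases h : m ∈ P.boundary T
    · obtain ⟨f, h1, h2⟩ := N.exists_boundary_element hT h
      refine ⟨f, fun _ => ⟨h1, span_mono (Set.image_mono ?_) h2⟩⟩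
      exact fun t ht => ⟨hT.1.subset ht.1, ht.2, ht.1⟩
    · exact ⟨0, fun h' => absurd h' h⟩
  choose f hf using hex
  have hf2 := fun m hm => (hf m hm).2
  let b : X × List E.Edge → M := fun m => P.basisOf T f m.1 m.2
  have hbT : ∀ t ∈ T, b t = P.word t := by
    rintro ⟨x, l⟩ ht
    cases l <;> simp [b, basisOf, ht]
  have hact : ∀ x e l, (x, e :: l) ∈ P.paths → (x, l) ∉ T →
      b (x, e :: l) = act e (b (x, l)) := by
    intro x e l _ hl
    have : (x, e :: l) ∉ T := fun h => hl (hT.1.tail x e l h)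
    simp [b, basisOf, this, hl]
  have hmem : ∀ x l, (x, l) ∈ P.paths → (x, l) ∉ T → b (x, l) ∈ N.carrier (P.cls (x, l)) := by
    intro x l
    induction l with
    | nil =>
      intro _ h
      have := (hf _ (boundary_of_nil (P := P) h)).1
      simpa [b, basisOf, h] using this
    | cons e l ih =>
      intro hp h
      by_cases h' : (x, l) ∈ T
      · have := (hf _ (boundary_of_cons hp h h')).1
        simpa [b, basisOf, h, h'] using this
      · rw [hact x e l hp h', cls_cons]
        apply N.act_mem
        have := ih hp.2 h'
        rw [hp.1]
        exact this
  refine ⟨T, b, hT.1.subset, hT.1.tail, ?_, ?_, hact, ?_⟩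
  · intro t ht hN
    have := (hT.1.indep (P.cls t)).ne_zero (i := t) ⟨ht, rfl⟩
    simp at this
    exact this hN
  · refine linearIndepOn_of_triangular (fun m => excess T m.1 m.2) P.linearIndep ?_
    rintro ⟨x, l⟩ hm
    refine span_mono (Set.image_mono ?_) (basisOf_sub_word hf2 x l hm)
    exact fun y hy => ⟨hy.1, hy.2.2⟩
  · intro c
    refine le_antisymm (fun r hr => ?_) (span_le.2 ?_)
    · have h1 : r ∈ span k (b '' {m | m ∈ P.paths ∧ P.cls m = c}) := by
        refine span_le.2 ?_ (N.le_comp c hr)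
        rintro _ ⟨⟨x, l⟩, ⟨hp, rfl⟩, rfl⟩
        exact word_mem_span_basisOf hf2 _ x l hp (Nat.lt_succ_self _)
      have h2 : {m | m ∈ P.paths ∧ P.cls m = c} = {m | m ∈ T ∧ P.cls m = c} ∪
          {m | m ∈ P.paths ∧ m ∉ T ∧ P.cls m = c} := by
        ext m
        have := @hT.1.subset m
        simp only [Set.mem_ofPred_eq, Set.mem_union]
        tauto
      rw [h2, Set.image_union, span_union] at h1
      obtain ⟨t, ht, n, hn, rfl⟩ := Submodule.mem_sup.1 h1
      have hnN : n ∈ N.carrier c := by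
        refine span_le.2 ?_ hn
        rintro _ ⟨⟨x, l⟩, ⟨hp, hT', rfl⟩, rfl⟩
        exact hmem x l hp hT'
      -- The part of `r` along `T` is a difference of two elements of the submodule, and `T` is
      -- independent modulo the submodule, so this part is zero.
      have htN : t ∈ N.carrier c := by simpa using sub_mem hr hnN
      have : t = 0 := by
        refine eq_zero_of_mem_span_of_linearIndepOn_mkQ (hT.1.indep c) ?_ htN
        convert ht using 2
        refine Set.image_congr fun m hm => (hbT m hm.1).symm
      rwa [this, zero_add]
    · rintro _ ⟨⟨x, l⟩, ⟨hp, hT', rfl⟩, rfl⟩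
      exact hmem x l hp hT'

end PathModule

end PathModule

/-! ### The defining relations and ghost paths in the Leavitt path algebra -/

section Relations

variable (k : Type*) [Field k] {E : DirGraph}

/-- An edge, as an element of `L_k(E)`. -/
noncomputable def LPA.edge (e : E.Edge) : LPA k E := LPA.mk k E (gen k (.edge e))

/-- A ghost edge, as an element of `L_k(E)`. -/
noncomputable def LPA.ghost (e : E.Edge) : LPA k E := LPA.mk k E (gen k (.ghost e))

namespace LPA

variable {k} in
theorem mk_eq_zero {x : FreeAlg k E} (h : Relator k E x) : LPA.mk k E x = 0 :=
  Quotient.sound' ((TwoSidedIdeal.mem_iff _ _).1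
    (TwoSidedIdeal.subset_span ⟨1, x, h, (one_smul k x).symm⟩))

theorem vert_mul_vert {v w : E.Vert} (h : v ≠ w) : vert k v * vert k w = 0 := by
  simpa [vert] using mk_eq_zero (Relator.vert_mul_vert (k := k) v w h)

theorem src_mul_edge (e : E.Edge) : vert k (E.src e) * edge k e = edge k e := by
  simpa [vert, edge, sub_eq_zero] using mk_eq_zero (Relator.src_mul_edge (k := k) e)

theorem edge_mul_rng (e : E.Edge) : edge k e * vert k (E.rng e) = edge k e := by
  simpa [vert, edge, sub_eq_zero] using mk_eq_zero (Relator.edge_mul_rng (k := k) e)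

theorem rng_mul_ghost (e : E.Edge) : vert k (E.rng e) * ghost k e = ghost k e := by
  simpa [vert, ghost, sub_eq_zero] using mk_eq_zero (Relator.rng_mul_ghost (k := k) e)

theorem ghost_mul_src (e : E.Edge) : ghost k e * vert k (E.src e) = ghost k e := by
  simpa [vert, ghost, sub_eq_zero] using mk_eq_zero (Relator.ghost_mul_src (k := k) e)

theorem ghost_mul_edge_self (e : E.Edge) : ghost k e * edge k e = vert k (E.rng e) := by
  simpa [vert, edge, ghost, sub_eq_zero] using mk_eq_zero (Relator.ghost_mul_self (k := k) e)

theorem ghost_mul_edge {e f : E.Edge} (h : e ≠ f) : ghost k e * edge k f = 0 := by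
  simpa [edge, ghost] using mk_eq_zero (Relator.ghost_mul_edge (k := k) e f h)

theorem vert_eq_sum {v : E.Vert} (hfin : {e : E.Edge | E.src e = v}.Finite)
    (hv : ¬ E.IsSink v) : vert k v = ∑ e ∈ hfin.toFinset, edge k e * ghost k e := by
  have hne : {e : E.Edge | E.src e = v}.Nonempty := by
    simp only [IsSink, not_forall, not_not] at hv
    exact hv
  simpa [vert, edge, ghost, sub_eq_zero] using
    mk_eq_zero (Relator.vert_sub_sum (k := k) v hfin hne)

theorem vert_mul_edge {v : E.Vert} {e : E.Edge} (h : E.src e ≠ v) :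
    vert k v * edge k e = 0 := by
  rw [← src_mul_edge, ← mul_assoc, vert_mul_vert k h.symm, zero_mul]

theorem ghost_mul_vert {v : E.Vert} {e : E.Edge} (h : E.src e ≠ v) :
    ghost k e * vert k v = 0 := by
  rw [← ghost_mul_src, mul_assoc, vert_mul_vert k h, mul_zero]

theorem edge_mem (e : E.Edge) : edge k e ∈ grading k E 1 :=
  subset_span ⟨FreeSemigroup.of (.edge e), by simp [wordDegree, Gen.degree], rfl⟩

theorem ghost_mem (e : E.Edge) : ghost k e ∈ grading k E (-1) :=
  subset_span ⟨FreeSemigroup.of (.ghost e), by simp [wordDegree, Gen.degree], rfl⟩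

variable {k} in
/-- The Leavitt path algebra is spanned by the words in the generators. -/
theorem span_words : span k {x | ∃ w : FreeSemigroup (Gen E),
    x = LPA.mk k E (MonoidAlgebra.single w 1)} = ⊤ := by
  refine eq_top_iff.2 fun x _ => ?_
  obtain ⟨x, rfl⟩ := LPA.mk_surjective x
  induction x using MonoidAlgebra.induction_linear with
  | zero => rw [map_zero]; exact zero_mem _
  | add x y hx hy => rw [map_add]; exact add_mem (hx trivial) (hy trivial)
  | single w c =>
    have : MonoidAlgebra.single w c = c • (MonoidAlgebra.single w 1 : FreeAlg k E) := by
      rw [MonoidAlgebra.smul_single, smul_eq_mul, mul_one]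
    rw [this, LPA.mk_smul]
    exact smul_mem _ _ (subset_span ⟨w, rfl⟩)

/-- The ghost path of a path. -/
noncomputable def ghostPath (u : E.Vert) : List E.Edge → LPA k E
  | [] => vert k u
  | e :: l => ghost k e * ghostPath u l

theorem tip_mul_ghostPath (u : E.Vert) (l : List E.Edge) :
    vert k (tip u l) * ghostPath k u l = ghostPath k u l := by
  cases l with
  | nil => exact vert_mul_self k u
  | cons e l => rw [ghostPath, ← mul_assoc, tip, rng_mul_ghost]

theorem ghostPath_mul_vert (u : E.Vert) (l : List E.Edge) :
    ghostPath k u l * vert k u = ghostPath k u l := by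
  induction l with
  | nil => exact vert_mul_self k u
  | cons e l ih => rw [ghostPath, mul_assoc, ih]

theorem vert_mul_ghostPath {u v : E.Vert} {l : List E.Edge} (h : tip u l ≠ v) :
    vert k v * ghostPath k u l = 0 := by
  rw [← tip_mul_ghostPath, ← mul_assoc, vert_mul_vert k h.symm, zero_mul]

theorem ghostPath_mul_vert_ne {u v : E.Vert} {l : List E.Edge} (h : u ≠ v) :
    ghostPath k u l * vert k v = 0 := by
  rw [← ghostPath_mul_vert, mul_assoc, vert_mul_vert k h, mul_zero]

theorem ghost_mul_ghostPath {u : E.Vert} {e : E.Edge} {l : List E.Edge} (h : E.src e ≠ tip u l) :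
    ghost k e * ghostPath k u l = 0 := by
  rw [← tip_mul_ghostPath, ← mul_assoc, ghost_mul_vert k h, zero_mul]

end LPA

end Relations

/-! ## A faithful enough representation -/

section Representation

variable {k : Type*} [Field k] {E : DirGraph}

/-- The data of a representation of `L_k(E)` by partial injections of `E⁰ × ℕ`: the edges `e` give
injections of `ℕ` at the range of `e` into `ℕ` at the source of `e`. -/
theorem exists_partition (hE : E.RowFinite) : ∃ θ : E.Edge → ℕ → ℕ,
    (∀ e f m n, E.src e = E.src f → θ e m = θ f n → e = f ∧ m = n) ∧
    ∀ v, ¬ E.IsSink v → ∀ n, ∃ e m, E.src e = v ∧ θ e m = n := by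
  have hv (v : E.Vert) (h : ¬ E.IsSink v) : Nonempty ({e : E.Edge | E.src e = v} × ℕ ≃ ℕ) := by
    simp only [IsSink, not_forall, not_not] at h
    have := (hE v).to_subtype
    have : Nonempty {e : E.Edge | E.src e = v} := ⟨⟨h.choose, h.choose_spec⟩⟩
    exact nonempty_equiv_of_countable
  have hs (e : E.Edge) : ¬ E.IsSink (E.src e) := fun h => h e rfl
  refine ⟨fun e n => (hv _ (hs e)).some (⟨e, rfl⟩, n), fun e f m n hef h => ?_, fun v h n => ?_⟩
  -- The bijection depends on the source vertex, so the two sources are generalized before they are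
  -- identified.
  · have key : ∀ (v w : E.Vert) (hvv : ¬ E.IsSink v) (hww : ¬ E.IsSink w) (x : {e | E.src e = v})
        (y : {e | E.src e = w}), v = w → (hv v hvv).some (x, m) = (hv w hww).some (y, n) →
        (x : E.Edge) = y ∧ m = n := by
      rintro v w hvv hww x y rfl hxy
      have := (hv v hvv).some.injective hxy
      simp only [Prod.mk.injEq] at this
      exact ⟨congrArg _ this.1, this.2⟩
    exact key _ _ (hs e) (hs f) ⟨e, rfl⟩ ⟨f, rfl⟩ hef h
  · obtain ⟨⟨⟨e, he⟩, m⟩, hm⟩ := (hv v h).some.surjective n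
    subst he
    exact ⟨e, m, rfl, hm⟩

/-- The functions on which the Leavitt path algebra is represented. -/
abbrev RepSpace (k : Type*) (E : DirGraph) : Type _ := E.Vert → ℕ → ℤ → k

open Classical in
/-- The operators by which the generators act. -/
noncomputable def repGen (k : Type*) [Field k] {E : DirGraph} (θ : E.Edge → ℕ → ℕ) :
    Gen E → Module.End k (RepSpace k E)
  | .vert v =>
    { toFun := fun f u n z => if u = v then f u n z else 0
      map_add' := fun f g => by ext u n z; simp only [Pi.add_apply]; split_ifs <;> simp
      map_smul' := fun c f => by ext u n z; simp }
  | .edge e =>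
    { toFun := fun f u n z =>
        if h : u = E.src e ∧ ∃ m, θ e m = n then f (E.rng e) h.2.choose (z - 1) else 0
      map_add' := fun f g => by ext u n z; simp only [Pi.add_apply]; split_ifs <;> simp
      map_smul' := fun c f => by
        ext u n z; simp only [Pi.smul_apply, RingHom.id_apply]; split_ifs <;> simp }
  | .ghost e =>
    { toFun := fun f u n z => if u = E.rng e then f (E.src e) (θ e n) (z + 1) else 0
      map_add' := fun f g => by ext u n z; simp only [Pi.add_apply]; split_ifs <;> simp
      map_smul' := fun c f => by ext u n z; simp }

/-- The representation of the free algebra. -/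
noncomputable def freeRep (k : Type*) [Field k] {E : DirGraph} (θ : E.Edge → ℕ → ℕ) :
    FreeAlg k E →ₙₐ[k] Module.End k (RepSpace k E) :=
  MonoidAlgebra.liftMagma k (FreeSemigroup.lift (repGen k θ))

theorem freeRep_gen (θ : E.Edge → ℕ → ℕ) (x : Gen E) : freeRep k θ (gen k x) = repGen k θ x := by
  simp [freeRep, gen, MonoidAlgebra.liftMagma_apply_apply]

variable {θ : E.Edge → ℕ → ℕ}

theorem repGen_vert (v : E.Vert) (f : RepSpace k E) (u : E.Vert) (n : ℕ) (z : ℤ) [Decidable (u = v)] :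
    repGen k θ (.vert v) f u n z = if u = v then f u n z else 0 := by
  simp [repGen]

theorem repGen_ghost (e : E.Edge) (f : RepSpace k E) (u : E.Vert) (n : ℕ) (z : ℤ)
    [Decidable (u = E.rng e)] :
    repGen k θ (.ghost e) f u n z = if u = E.rng e then f (E.src e) (θ e n) (z + 1) else 0 := by
  simp [repGen]

theorem repGen_edge_of_eq (hθ : ∀ e f m n, E.src e = E.src f → θ e m = θ f n → e = f ∧ m = n)
    (e : E.Edge) (f : RepSpace k E) (m : ℕ) (z : ℤ) :
    repGen k θ (.edge e) f (E.src e) (θ e m) z = f (E.rng e) m (z - 1) := by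
  have h : E.src e = E.src e ∧ ∃ m', θ e m' = θ e m := ⟨rfl, m, rfl⟩
  have h' := (hθ e e _ _ rfl h.2.choose_spec).2
  simp only [repGen, LinearMap.coe_mk, AddHom.coe_mk, dif_pos h]
  rw [h']

theorem repGen_edge_of_ne (e : E.Edge) (f : RepSpace k E) (u : E.Vert) (n : ℕ) (z : ℤ)
    (h : ¬ (u = E.src e ∧ ∃ m, θ e m = n)) : repGen k θ (.edge e) f u n z = 0 := by
  simp only [repGen, LinearMap.coe_mk, AddHom.coe_mk, dif_neg h]

theorem freeRep_relator (hθ : ∀ e f m n, E.src e = E.src f → θ e m = θ f n → e = f ∧ m = n)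
    (hθ' : ∀ v, ¬ E.IsSink v → ∀ n, ∃ e m, E.src e = v ∧ θ e m = n) {x : FreeAlg k E}
    (hx : Relator k E x) : freeRep k θ x = 0 := by
  classical
  -- The operator of an edge is defined by a choice of preimage under `θ e`; splitting on whether
  -- one exists reduces the relations to `repGen_edge_of_eq` and `repGen_edge_of_ne`.
  have hedge (e : E.Edge) (u : E.Vert) (n : ℕ) (P : Prop)
      (h1 : ∀ m, u = E.src e → θ e m = n → P) (h2 : ¬ (u = E.src e ∧ ∃ m, θ e m = n) → P) : P := by
    by_cases h : u = E.src e ∧ ∃ m, θ e m = n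
    · obtain ⟨hu, m, hm⟩ := h
      exact h1 m hu hm
    · exact h2 h
  induction hx with
  | vert_mul_self v =>
    simp only [map_sub, map_mul, freeRep_gen, sub_eq_zero]
    ext f u n z
    simp only [Module.End.mul_apply, repGen_vert]
    split_ifs <;> rfl
  | vert_mul_vert v w h =>
    simp only [map_mul, freeRep_gen]
    ext f u n z
    simp only [Module.End.mul_apply, repGen_vert, LinearMap.zero_apply, Pi.zero_apply]
    split_ifs with h1 h2
    · exact absurd (h1.symm.trans h2) h
    all_goals rfl
  | src_mul_edge e =>
    simp only [map_sub, map_mul, freeRep_gen, sub_eq_zero]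
    ext f u n z
    simp only [Module.End.mul_apply, repGen_vert]
    split_ifs with h
    · rfl
    · rw [repGen_edge_of_ne _ _ _ _ _ (fun h' => h h'.1)]
  | edge_mul_rng e =>
    simp only [map_sub, map_mul, freeRep_gen, sub_eq_zero]
    ext f u n z
    rw [Module.End.mul_apply]
    refine hedge e u n _ (fun m hu hm => ?_) fun h => ?_
    · subst hu hm
      rw [repGen_edge_of_eq hθ, repGen_edge_of_eq hθ, repGen_vert, if_pos rfl]
    · rw [repGen_edge_of_ne _ _ _ _ _ h, repGen_edge_of_ne _ _ _ _ _ h]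
  | rng_mul_ghost e =>
    simp only [map_sub, map_mul, freeRep_gen, sub_eq_zero]
    ext f u n z
    simp only [Module.End.mul_apply, repGen_vert, repGen_ghost]
    split_ifs <;> rfl
  | ghost_mul_src e =>
    simp only [map_sub, map_mul, freeRep_gen, sub_eq_zero]
    ext f u n z
    simp [Module.End.mul_apply, repGen_vert, repGen_ghost]
  | ghost_mul_self e =>
    simp only [map_sub, map_mul, freeRep_gen, sub_eq_zero]
    ext f u n z
    simp only [Module.End.mul_apply, repGen_vert, repGen_ghost]
    split_ifs with h
    · rw [repGen_edge_of_eq hθ, h, add_sub_cancel_right]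
    · rfl
  | ghost_mul_edge e e' h =>
    simp only [map_mul, freeRep_gen]
    ext f u n z
    simp only [Module.End.mul_apply, repGen_ghost]
    split_ifs
    · rw [repGen_edge_of_ne]
      · rfl
      · rintro ⟨h1, m, h2⟩
        exact h (hθ _ _ _ _ h1.symm h2).1.symm
    · rfl
  | vert_sub_sum v hfin hne =>
    simp only [map_sub, map_mul, map_sum, freeRep_gen, sub_eq_zero]
    ext f u n z
    simp only [LinearMap.sum_apply, Finset.sum_apply, repGen_vert, Module.End.mul_apply]
    split_ifs with h
    · subst h
      obtain ⟨e, m, he, hm⟩ := hθ' u (by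
        obtain ⟨e, he⟩ := hne
        exact fun h => h e he) n
      subst he hm
      rw [Finset.sum_eq_single e]
      · rw [repGen_edge_of_eq hθ, repGen_ghost, if_pos rfl, sub_add_cancel]
      · intro e' _ hne
        rw [repGen_edge_of_ne]
        rintro ⟨h1, m', h2⟩
        exact hne (hθ _ _ _ _ h1.symm h2).1
      · intro h
        simp at h
    · refine (Finset.sum_eq_zero fun e he => ?_).symm
      rw [repGen_edge_of_ne]
      rintro ⟨h1, -⟩
      exact h (h1.trans (by simpa using he))

theorem exists_rep (hθ : ∀ e f m n, E.src e = E.src f → θ e m = θ f n → e = f ∧ m = n)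
    (hθ' : ∀ v, ¬ E.IsSink v → ∀ n, ∃ e m, E.src e = v ∧ θ e m = n) :
    ∃ ρ : LPA k E →ₗ[k] Module.End k (RepSpace k E), (∀ x y, ρ (x * y) = ρ x * ρ y) ∧
      (∀ v, ρ (LPA.vert k v) = repGen k θ (.vert v)) ∧
      (∀ e, ρ (LPA.ghost k e) = repGen k θ (.ghost e)) := by
  have hker : relIdeal k E ≤ TwoSidedIdeal.ker (freeRep k θ) := by
    refine TwoSidedIdeal.span_le.2 ?_
    rintro _ ⟨c, y, hy, rfl⟩
    change _ ∈ TwoSidedIdeal.ker _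
    rw [TwoSidedIdeal.mem_ker, map_smul, freeRep_relator hθ hθ' hy, smul_zero]
  let F : LPA k E → Module.End k (RepSpace k E) := Quotient.lift (freeRep k θ) fun x y h => by
    have h' : x - y ∈ relIdeal k E := (TwoSidedIdeal.rel_iff _ _ _).1 h
    have := hker h'
    rwa [TwoSidedIdeal.mem_ker, map_sub, sub_eq_zero] at this
  have hF (x) : F (LPA.mk k E x) = freeRep k θ x := rfl
  let F' : LPA k E →ₗ[k] Module.End k (RepSpace k E) :=
    { toFun := F
      map_add' := fun x y => by
        obtain ⟨x, rfl⟩ := LPA.mk_surjective x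
        obtain ⟨y, rfl⟩ := LPA.mk_surjective y
        rw [← map_add, hF, hF, hF, map_add]
      map_smul' := fun c x => by
        obtain ⟨x, rfl⟩ := LPA.mk_surjective x
        rw [← LPA.mk_smul, hF, hF, map_smul]; rfl }
  have hF' (x) : F' (LPA.mk k E x) = freeRep k θ x := rfl
  refine ⟨F', fun x y => ?_, fun v => freeRep_gen θ _, fun e => freeRep_gen θ _⟩
  obtain ⟨x, rfl⟩ := LPA.mk_surjective x
  obtain ⟨y, rfl⟩ := LPA.mk_surjective y
  rw [← map_mul, hF', hF', hF', map_mul]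

/-- The point to which the tail of a path is carried by the path. -/
def code (θ : E.Edge → ℕ → ℕ) : List E.Edge → ℕ → ℕ
  | [], n => n
  | e :: l, n => code θ l (θ e n)

/-- Read from the start of the path, `code` applies nested injections whose images are disjoint for
distinct edges with the same source. Paths of different lengths may have the same code, hence the
hypothesis on lengths. -/
theorem code_injective (hθ : ∀ e f m n, E.src e = E.src f → θ e m = θ f n → e = f ∧ m = n)
    {u : E.Vert} : ∀ {l l' : List E.Edge} {n n' : ℕ}, IsPath u l → IsPath u l' →
    l.length = l'.length → code θ l n = code θ l' n' → l = l' ∧ n = n'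
  | [], [], _, _, _, _, _, h => ⟨rfl, h⟩
  | e :: l, e' :: l', n, n', hl, hl', hlen, h => by
    obtain ⟨rfl, h2⟩ := code_injective hθ hl.2 hl'.2 (by simpa using hlen) h
    obtain ⟨rfl, rfl⟩ := hθ _ _ _ _ (hl.1.trans hl'.1.symm) h2
    exact ⟨rfl, rfl⟩

open Classical in
/-- The ghost paths have a dual family of linear functionals, so they are linearly independent. -/
theorem exists_dual_ghostPath (k : Type*) [Field k] (hE : E.RowFinite) (u : E.Vert)
    (l : List E.Edge) (hl : IsPath u l) :
    ∃ φ : LPA k E →ₗ[k] k, ∀ u' l', IsPath u' l' →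
      φ (LPA.ghostPath k u' l') = if u' = u ∧ l' = l then 1 else 0 := by
  classical
  obtain ⟨θ, hθ, hθ'⟩ := exists_partition hE
  obtain ⟨ρ, hmul, hvert, hghost⟩ := exists_rep (k := k) hθ hθ'
  have key (u : E.Vert) (l : List E.Edge) (hl : IsPath u l) (f : RepSpace k E) (t : E.Vert) :
      ∀ (n : ℕ) (z : ℤ), ρ (LPA.ghostPath k u l) f t n z =
        if t = tip u l then f u (code θ l n) (z + l.length) else 0 := by
    induction l generalizing t with
    | nil =>
      intro n z
      by_cases h : t = u <;> simp [LPA.ghostPath, hvert, repGen_vert, tip, code, h]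
    | cons e l ih =>
      intro n z
      simp only [LPA.ghostPath, hmul, hghost, Module.End.mul_apply, repGen_ghost, tip]
      rw [ih hl.2, if_pos hl.1]
      simp only [code, List.length_cons]
      push_cast
      rw [add_assoc, add_comm 1 (l.length : ℤ)]
  -- A delta function, to be evaluated after the action at the end of the path, the point `0` and
  -- the integer `0`. The integer coordinate records the length, which `code` does not detect.
  let f : RepSpace k E := fun u' n z => if u' = u ∧ n = code θ l 0 ∧ z = l.length then 1 else 0
  refine ⟨LinearMap.proj 0 ∘ₗ LinearMap.proj 0 ∘ₗ LinearMap.proj (tip u l) ∘ₗ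
    LinearMap.applyₗ f ∘ₗ ρ, fun u' l' hl' => ?_⟩
  simp only [LinearMap.comp_apply, LinearMap.proj_apply, LinearMap.applyₗ_apply_apply]
  rw [key u' l' hl']
  by_cases h : u' = u ∧ l' = l
  · obtain ⟨rfl, rfl⟩ := h
    simp [f]
  · rw [if_neg h]
    split_ifs with ht
    · simp only [f, zero_add]
      rw [if_neg]
      rintro ⟨rfl, h1, h2⟩
      exact h ⟨rfl, (code_injective hθ hl' hl (by exact_mod_cast h2) h1).1⟩
    · rfl

end Representation

/-! ### The filtration of the Leavitt path algebra by the ghost paths needed to reach the ghost span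
-/

section Levels

variable (k : Type*) [Field k] (E : DirGraph) (ε : ℤ)

namespace LPA

/-- The span of the ghost paths of degree `n`, when edges have degree `ε`. -/
noncomputable def ghostSpan (n : ℤ) : Submodule k (LPA k E) :=
  span k {x | ∃ u l, IsPath u l ∧ -(ε * (l : List E.Edge).length) = n ∧ x = ghostPath k u l}

/-- The elements that are carried into the span of the ghost paths by the ghost paths that have
length `K`, or that end at a sink. -/
noncomputable def level : ℕ → ℤ → Submodule k (LPA k E)
  | 0, n => ghostSpan k E ε n
  | K + 1, n => (⨅ e, (level K (n - ε)).comap (LinearMap.mulLeft k (ghost k e))) ⊓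
      ⨅ (v) (_ : E.IsSink v), (ghostSpan k E ε n).comap (LinearMap.mulLeft k (vert k v))

variable {k E ε}

theorem mem_level_succ {K : ℕ} {n : ℤ} {a : LPA k E} : a ∈ level k E ε (K + 1) n ↔
    (∀ e, ghost k e * a ∈ level k E ε K (n - ε)) ∧
      ∀ v, E.IsSink v → vert k v * a ∈ ghostSpan k E ε n := by
  simp [level]

theorem vert_mul_mem_ghostSpan (v : E.Vert) {n : ℤ} {a : LPA k E} (ha : a ∈ ghostSpan k E ε n) :
    vert k v * a ∈ ghostSpan k E ε n := by
  suffices h : ghostSpan k E ε n ≤ (ghostSpan k E ε n).comap (LinearMap.mulLeft k (vert k v)) from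
    h ha
  refine span_le.2 ?_
  rintro _ ⟨u, l, hl, hn, rfl⟩
  simp only [SetLike.mem_coe, mem_comap, LinearMap.mulLeft_apply]
  by_cases h : tip u l = v
  · subst h
    rw [tip_mul_ghostPath]
    exact subset_span ⟨u, l, hl, hn, rfl⟩
  · rw [vert_mul_ghostPath k h]
    exact zero_mem _

theorem ghost_mul_mem_ghostSpan (e : E.Edge) {n : ℤ} {a : LPA k E} (ha : a ∈ ghostSpan k E ε n) :
    ghost k e * a ∈ ghostSpan k E ε (n - ε) := by
  suffices h : ghostSpan k E ε n ≤
    (ghostSpan k E ε (n - ε)).comap (LinearMap.mulLeft k (ghost k e)) from h ha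
  refine span_le.2 ?_
  rintro _ ⟨u, l, hl, hn, rfl⟩
  simp only [SetLike.mem_coe, mem_comap, LinearMap.mulLeft_apply]
  by_cases h : E.src e = tip u l
  · refine subset_span ⟨u, e :: l, ⟨h, hl⟩, ?_, rfl⟩
    rw [← hn, List.length_cons]
    push_cast
    ring
  · rw [ghost_mul_ghostPath k h]
    exact zero_mem _

theorem level_le_succ (K : ℕ) (n : ℤ) : level k E ε K n ≤ level k E ε (K + 1) n := by
  induction K generalizing n with
  | zero => exact fun a ha => mem_level_succ.2 ⟨fun e => ghost_mul_mem_ghostSpan e ha, fun v _ => vert_mul_mem_ghostSpan v ha⟩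
  | succ K ih => exact fun a ha => mem_level_succ.2 ⟨fun e => ih _ ((mem_level_succ.1 ha).1 e), (mem_level_succ.1 ha).2⟩

theorem level_mono {K K' : ℕ} (h : K ≤ K') (n : ℤ) : level k E ε K n ≤ level k E ε K' n :=
  monotone_nat_of_le_succ (f := fun K => level k E ε K n) (fun K => level_le_succ K n) h

theorem ghost_mul_mem_level (e : E.Edge) {K : ℕ} {n : ℤ} {a : LPA k E}
    (ha : a ∈ level k E ε K n) : ghost k e * a ∈ level k E ε K (n - ε) := by
  cases K with
  | zero => exact ghost_mul_mem_ghostSpan e ha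
  | succ K => exact level_le_succ _ _ ((mem_level_succ.1 ha).1 e)

theorem vert_mul_mem_level (v : E.Vert) {K : ℕ} {n : ℤ} {a : LPA k E}
    (ha : a ∈ level k E ε K n) : vert k v * a ∈ level k E ε K n := by
  cases K with
  | zero => exact vert_mul_mem_ghostSpan v ha
  | succ K =>
    refine mem_level_succ.2 ⟨fun e => ?_, fun w hw => ?_⟩
    · rw [← mul_assoc]
      by_cases h : E.src e = v
      · subst h
        rw [ghost_mul_src]
        exact (mem_level_succ.1 ha).1 e
      · rw [ghost_mul_vert k h, zero_mul]; exact zero_mem _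
    · rw [← mul_assoc]
      by_cases h : w = v
      · subst h
        rw [vert_mul_self]
        exact (mem_level_succ.1 ha).2 w hw
      · rw [vert_mul_vert k h, zero_mul]; exact zero_mem _

theorem edge_mul_mem_level (f : E.Edge) {K : ℕ} {n : ℤ} {a : LPA k E}
    (ha : a ∈ level k E ε K n) : edge k f * a ∈ level k E ε (K + 1) (n + ε) := by
  refine mem_level_succ.2 ⟨fun e => ?_, fun w hw => ?_⟩
  · rw [← mul_assoc, add_sub_cancel_right]
    by_cases h : e = f
    · subst h
      rw [ghost_mul_edge_self]
      exact vert_mul_mem_level _ ha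
    · rw [ghost_mul_edge k h, zero_mul]; exact zero_mem _
  · rw [← mul_assoc, vert_mul_edge k (hw f), zero_mul]; exact zero_mem _

theorem vert_mem_ghostSpan (v : E.Vert) : vert k v ∈ ghostSpan k E ε 0 :=
  subset_span ⟨v, [], trivial, by simp, rfl⟩

/-- Left multiplication by a generator raises the level by at most one: the relations
$e^*f=\delta_{e,f}r(e)$ cancel an edge, while vertices and ghost edges preserve every level. -/
theorem word_mem_level (w : FreeSemigroup (Gen E)) : ∃ K,
    mk k E (MonoidAlgebra.single w 1) ∈ level k E ε K (ε * (wordDegree E w).toAdd) := by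
  have hmul (x : Gen E) {K : ℕ} {n : ℤ} {a : LPA k E} (ha : a ∈ level k E ε K n) :
      mk k E (gen k x) * a ∈ level k E ε (K + 1) (ε * x.degree + n) := by
    cases x with
    | vert v =>
      simp only [Gen.degree, mul_zero, zero_add]
      exact level_le_succ _ _ (vert_mul_mem_level v ha)
    | edge e =>
      simp only [Gen.degree, mul_one, add_comm ε]
      exact edge_mul_mem_level e ha
    | ghost e =>
      simp only [Gen.degree, mul_neg, mul_one, neg_add_eq_sub]
      exact level_le_succ _ _ (ghost_mul_mem_level e ha)
  induction w using FreeSemigroup.recOnMul with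
  | ih1 x =>
    refine ⟨1, ?_⟩
    -- A single letter is the product of itself with a vertex, so it is covered by `hmul`.
    have h0 (v : E.Vert) : vert k v ∈ level k E ε 0 0 := vert_mem_ghostSpan v
    have : (wordDegree E (FreeSemigroup.of x)).toAdd = x.degree := by simp [wordDegree]
    rw [this, ← add_zero (ε * x.degree)]
    change mk k E (gen k x) ∈ _
    cases x with
    | vert v =>
      have := hmul (.vert v) (h0 v)
      rwa [show mk k E (gen k (.vert v)) = vert k v from rfl, vert_mul_self] at this
    | edge e =>
      have := hmul (.edge e) (h0 (E.rng e))
      rwa [show mk k E (gen k (.edge e)) = edge k e from rfl, edge_mul_rng] at this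
    | ghost e =>
      have := hmul (.ghost e) (h0 (E.src e))
      rwa [show mk k E (gen k (.ghost e)) = ghost k e from rfl, ghost_mul_src] at this
  | ih2 x w _ ih =>
    obtain ⟨K, hK⟩ := ih
    refine ⟨K + 1, ?_⟩
    have := hmul x hK
    rw [gen, ← map_mul, MonoidAlgebra.single_mul_single, one_mul] at this
    convert this using 1
    rw [map_mul, toAdd_mul, mul_add]
    simp [wordDegree]

/-- Used twice: with `ε = 1` and the words of one degree for the graded case, and with `ε = 0` and
all words when the grading is forgotten. -/
theorem exists_mem_level_of_span {S : Set (FreeSemigroup (Gen E))} {n : ℤ}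
    (hS : ∀ w ∈ S, ε * (wordDegree E w).toAdd = n) {a : LPA k E}
    (ha : a ∈ span k {x | ∃ w ∈ S, x = mk k E (MonoidAlgebra.single w 1)}) :
    ∃ K, a ∈ level k E ε K n := by
  induction ha using Submodule.span_induction with
  | mem x hx =>
    obtain ⟨w, hw, rfl⟩ := hx
    obtain ⟨K, hK⟩ := word_mem_level (k := k) (ε := ε) w
    exact ⟨K, by rwa [hS w hw] at hK⟩
  | zero => exact ⟨0, zero_mem _⟩
  | add x y _ _ hx hy =>
    obtain ⟨K, hK⟩ := hx
    obtain ⟨K', hK'⟩ := hy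
    exact ⟨max K K', add_mem (level_mono (le_max_left _ _) _ hK)
      (level_mono (le_max_right _ _) _ hK')⟩
  | smul c x _ hx =>
    obtain ⟨K, hK⟩ := hx
    exact ⟨K, smul_mem _ _ hK⟩

theorem exists_mem_level_of_mem_grading {n : ℤ} {a : LPA k E} (ha : a ∈ grading k E n) :
    ∃ K, a ∈ level k E 1 K n := by
  refine exists_mem_level_of_span (S := {w | wordDegree E w = Multiplicative.ofAdd n}) ?_ ha
  intro w hw
  rw [one_mul, hw, toAdd_ofAdd]

theorem exists_mem_level (a : LPA k E) : ∃ K, a ∈ level k E 0 K 0 := by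
  refine exists_mem_level_of_span (S := Set.univ) (fun w _ => by rw [zero_mul]) ?_
  have : a ∈ (⊤ : Submodule k (LPA k E)) := trivial
  rw [← span_words] at this
  simpa using this

theorem exists_mem_level_of_finite {ι : Type*} [Finite ι] {n : ι → ℤ} {a : ι → LPA k E}
    (ha : ∀ i, ∃ K, a i ∈ level k E ε K (n i)) : ∃ K, ∀ i, a i ∈ level k E ε K (n i) := by
  choose K hK using ha
  obtain ⟨K', hK'⟩ := (Set.finite_range K).bddAbove
  exact ⟨K', fun i => level_mono (hK' ⟨i, rfl⟩) _ (hK i)⟩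

/-- The vertices are local units. -/
theorem exists_sum_vert_mul (a : LPA k E) : ∃ S : Finset E.Vert, ∀ S', S ⊆ S' →
    ∑ v ∈ S', vert k v * a = a := by
  classical
  have ha : a ∈ (⊤ : Submodule k (LPA k E)) := trivial
  rw [← span_words] at ha
  induction ha using Submodule.span_induction with
  | mem x hx =>
    obtain ⟨w, rfl⟩ := hx
    have hgen (x : Gen E) : ∃ u, vert k u * mk k E (gen k x) = mk k E (gen k x) := by
      cases x with
      | vert v => exact ⟨v, vert_mul_self k v⟩
      | edge e => exact ⟨E.src e, src_mul_edge k e⟩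
      | ghost e => exact ⟨E.rng e, rng_mul_ghost k e⟩
    have hw : ∃ u, vert k u * mk k E (MonoidAlgebra.single w 1) =
        mk k E (MonoidAlgebra.single w 1) := by
      induction w using FreeSemigroup.recOnMul with
      | ih1 x => exact hgen x
      | ih2 x w _ _ =>
        obtain ⟨u, hu⟩ := hgen x
        refine ⟨u, ?_⟩
        have : mk k E (MonoidAlgebra.single (FreeSemigroup.of x * w) 1) =
            mk k E (gen k x) * mk k E (MonoidAlgebra.single w 1) := by
          rw [gen, ← map_mul, MonoidAlgebra.single_mul_single, one_mul]
        rw [this, ← mul_assoc, hu]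
    obtain ⟨u, hu⟩ := hw
    refine ⟨{u}, fun S' hS' => ?_⟩
    rw [Finset.sum_eq_single u, hu]
    · intro v _ hv
      rw [← hu, ← mul_assoc, vert_mul_vert k hv, zero_mul]
    · exact fun h => absurd (hS' (Finset.mem_singleton_self u)) h
  | zero => exact ⟨∅, fun S' _ => by simp⟩
  | add x y _ _ hx hy =>
    obtain ⟨S, hS⟩ := hx
    obtain ⟨S', hS'⟩ := hy
    refine ⟨S ∪ S', fun S'' h => ?_⟩
    simp only [mul_add, Finset.sum_add_distrib]
    rw [hS _ (Finset.union_subset_left h), hS' _ (Finset.union_subset_right h)]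
  | smul c x _ hx =>
    obtain ⟨S, hS⟩ := hx
    refine ⟨S, fun S' h => ?_⟩
    simp only [mul_smul_comm, ← Finset.smul_sum]
    rw [hS _ h]

/-- At a non-sink $v=\sum ee^*$, so $va$ is recovered from the products $e^*a$. At a sink there is
no such relation, which is why sinks enter separately here and in `level`. -/
theorem eq_zero_of_ghost_mul (hE : E.RowFinite) {a : LPA k E} (h : ∀ e, ghost k e * a = 0)
    (h' : ∀ v, E.IsSink v → vert k v * a = 0) : a = 0 := by
  obtain ⟨S, hS⟩ := exists_sum_vert_mul a
  rw [← hS S subset_rfl]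
  refine Finset.sum_eq_zero fun v _ => ?_
  by_cases hv : E.IsSink v
  · exact h' v hv
  · rw [vert_eq_sum k (hE v) hv, Finset.sum_mul]
    exact Finset.sum_eq_zero fun e _ => by rw [mul_assoc, h, mul_zero]

theorem mem_span_of_mem_ghostSpan {n : ℤ} {u : E.Vert} {a : LPA k E}
    (ha : a ∈ ghostSpan k E ε n) (hu : a * vert k u = a) :
    a ∈ span k {x | ∃ l, IsPath u l ∧ x = ghostPath k u l} := by
  rw [← hu]
  clear hu
  induction ha using Submodule.span_induction with
  | mem x hx =>
    obtain ⟨v, l, hl, -, rfl⟩ := hx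
    by_cases h : v = u
    · subst h
      rw [ghostPath_mul_vert]
      exact subset_span ⟨l, hl, rfl⟩
    · rw [ghostPath_mul_vert_ne k h]
      exact zero_mem _
  | zero => rw [zero_mul]; exact zero_mem _
  | add x y _ _ hx hy => rw [add_mul]; exact add_mem hx hy
  | smul c x _ hx => rw [smul_mul_assoc]; exact smul_mem _ _ hx

end LPA

end Levels

/-! ### Rows over the Leavitt path algebra as free modules over the path algebra -/

section Rows

variable {k : Type*} [Field k] {E : DirGraph} {ι κ : Type*}

/-- Left multiplication of rows by an element. -/
noncomputable def lmul (a : LPA k E) : (ι → LPA k E) →ₗ[k] (ι → LPA k E) :=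
  (LinearMap.mulLeft k a).compLeft ι

@[simp]
theorem lmul_apply (a : LPA k E) (r : ι → LPA k E) (j : ι) : lmul a r j = a * r j := rfl

theorem lmul_mul (a b : LPA k E) (r : ι → LPA k E) : lmul (a * b) r = lmul a (lmul b r) := by
  ext j; simp [mul_assoc]

theorem lmul_zero_left (r : ι → LPA k E) : lmul 0 r = 0 := by
  ext j; simp

theorem lmul_sum (s : Finset κ) (a : κ → LPA k E) (r : ι → LPA k E) :
    lmul (∑ i ∈ s, a i) r = ∑ i ∈ s, lmul (a i) r := by
  ext j; simp [Finset.sum_mul]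

theorem lmul_add_left (a b : LPA k E) (r : ι → LPA k E) :
    lmul (a + b) r = lmul a r + lmul b r := by
  ext j; simp [add_mul]

theorem lmul_smul_left (c : k) (a : LPA k E) (r : ι → LPA k E) :
    lmul (c • a) r = c • lmul a r := by
  ext j; simp [smul_mul_assoc]

/-- Right multiplication of rows by a matrix. -/
noncomputable def rowMul [Fintype ι] (p : Matrix ι κ (LPA k E)) :
    (ι → LPA k E) →ₗ[k] (κ → LPA k E) where
  toFun r := Matrix.vecMul r p
  map_add' r r' := Matrix.add_vecMul p r r'
  map_smul' c r := by ext j; simp [Matrix.vecMul, dotProduct, Finset.smul_sum, smul_mul_assoc]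

theorem rowMul_apply [Fintype ι] (p : Matrix ι κ (LPA k E)) (r : ι → LPA k E) (j : κ) :
    rowMul p r j = ∑ i, r i * p i j := rfl

theorem rowMul_lmul [Fintype ι] (p : Matrix ι κ (LPA k E)) (a : LPA k E) (r : ι → LPA k E) :
    rowMul p (lmul a r) = lmul a (rowMul p r) := by
  ext j; simp [rowMul_apply, Finset.mul_sum, mul_assoc]

theorem rowMul_row [Fintype ι] {l : Type*} (q : Matrix l ι (LPA k E)) (p : Matrix ι κ (LPA k E))
    (i : l) : rowMul p (q i) = (q * p) i := by
  ext j; rw [rowMul_apply, Matrix.mul_apply]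

/-- The action of an edge on rows, by left multiplication with the ghost edge. -/
noncomputable def ghostAct (k : Type*) [Field k] {E : DirGraph} (ι : Type*) (e : E.Edge) :
    (ι → LPA k E) →ₗ[k] (ι → LPA k E) := lmul (LPA.ghost k e)

theorem linearIndepOn_of_dual {M ι : Type*} [AddCommGroup M] [Module k M] {b : ι → M} {S : Set ι}
    (h : ∀ i ∈ S, ∃ φ : M →ₗ[k] k, φ (b i) = 1 ∧ ∀ j ∈ S, j ≠ i → φ (b j) = 0) :
    LinearIndepOn k b S := by
  rw [linearIndepOn_iff']
  intro t c ht hsum i hi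
  obtain ⟨φ, h1, h2⟩ := h i (ht hi)
  have := congrArg φ hsum
  rw [map_sum, map_zero, Finset.sum_eq_single i] at this
  · simpa [h1] using this
  · intro j hj hne
    rw [map_smul, h2 j (ht hj) hne, smul_zero]
  · exact fun h => absurd hi h

open Classical in
/-- The free module over the path algebra on a family of rows that has a dual family of linear
functionals. -/
noncomputable def rowModule (hE : E.RowFinite) {X : Type*} (R : X → ι → LPA k E)
    (ω : X → E.Vert) (deg : X → ℤ) (ε : ℤ) (B : X → (ι → LPA k E) →ₗ[k] LPA k E)
    (hB : ∀ x x' a, B x (lmul a (R x')) = if x' = x then a * LPA.vert k (ω x) else 0) :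
    PathModule (ghostAct (E := E) k ι) X where
  root := ω
  deg := deg
  step := ε
  word m := lmul (LPA.ghostPath k (ω m.1) m.2) (R m.1)
  linearIndep := by
    refine linearIndepOn_of_dual ?_
    rintro ⟨x, l⟩ hl
    obtain ⟨φ, hφ⟩ := exists_dual_ghostPath k hE (ω x) l hl
    refine ⟨φ ∘ₗ B x, ?_, ?_⟩
    · simp only [LinearMap.comp_apply, hB, if_true, LPA.ghostPath_mul_vert]
      rw [hφ _ _ hl]
      simp
    · rintro ⟨x', l'⟩ hl' hne
      simp only [LinearMap.comp_apply, hB]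
      split_ifs with h
      · subst h
        rw [LPA.ghostPath_mul_vert, hφ _ _ hl', if_neg]
        rintro ⟨-, rfl⟩
        exact hne rfl
      · exact map_zero φ
  act_word x e l hl := by
    rw [ghostAct, ← lmul_mul]; rfl

/-- The free module over the path algebra on the vertices in the columns of a row. -/
noncomputable def columnModule [DecidableEq ι] (hE : E.RowFinite) (d : ι → ℤ) (ε : ℤ) :
    PathModule (ghostAct (E := E) k ι) (ι × E.Vert) :=
  rowModule hE (fun x => Pi.single x.1 (LPA.vert k x.2)) (fun x => x.2) (fun x => d x.1) ε
    (fun x => LinearMap.mulRight k (LPA.vert k x.2) ∘ₗ LinearMap.proj x.1) (by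
      rintro ⟨j, v⟩ ⟨j', v'⟩ a
      simp only [LinearMap.comp_apply, LinearMap.proj_apply, lmul_apply, LinearMap.mulRight_apply,
        Prod.mk.injEq]
      by_cases hj : j' = j
      · subst hj
        by_cases hv : v' = v
        · subst hv
          simp [mul_assoc, LPA.vert_mul_self]
        · simp [hv, mul_assoc, LPA.vert_mul_vert k hv]
      · rw [Pi.single_eq_of_ne (Ne.symm hj), if_neg (fun h => hj (congrArg Prod.fst h)), mul_zero, zero_mul])

end Rows

/-! ## Submodules of free modules and their extensions to the Leavitt path algebra -/

section Extension

variable {k : Type*} [Field k] {E : DirGraph} {ι X : Type*}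
variable {P : PathModule (ghostAct k ι) X} {T : Set (X × List E.Edge)}
  {b : X × List E.Edge → ι → LPA k E}

theorem exists_linearMap_of_linearIndepOn {M M' ι : Type*} [AddCommGroup M] [Module k M]
    [AddCommGroup M'] [Module k M'] {b : ι → M} {S : Set ι} (hb : LinearIndepOn k b S)
    (g : ι → M') : ∃ φ : M →ₗ[k] M', ∀ i ∈ S, φ (b i) = g i := by
  have hb' : LinearIndependent k (fun i : S => b i) := hb
  obtain ⟨φ, hφ⟩ := LinearMap.exists_extend
    ((Finsupp.linearCombination k fun i : S => g i) ∘ₗ hb'.repr)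
  refine ⟨φ, fun i hi => ?_⟩
  have h := LinearMap.congr_fun hφ ⟨b i, subset_span ⟨⟨i, hi⟩, rfl⟩⟩
  simp only [LinearMap.comp_apply, Submodule.subtype_apply] at h
  rw [h]
  have := hb'.repr_eq_single ⟨i, hi⟩ ⟨b i, subset_span ⟨⟨i, hi⟩, rfl⟩⟩ rfl
  simp [this]

theorem append_mem_paths {x : X} {l l' : List E.Edge} (h' : (x, l') ∈ P.paths)
    (h : IsPath (tip (P.root x) l') l) :
    (x, l ++ l') ∈ P.paths ∧ tip (P.root x) (l ++ l') = tip (tip (P.root x) l') l := by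
  induction l with
  | nil => exact ⟨h', rfl⟩
  | cons e l ih =>
    obtain ⟨h1, h2⟩ := ih h.2
    exact ⟨⟨h.1.trans h2.symm, h1⟩, rfl⟩

theorem append_notMem (hT : ∀ x e l, (x, e :: l) ∈ T → (x, l) ∈ T) {x : X} {l l' : List E.Edge}
    (h' : (x, l') ∉ T) : (x, l ++ l') ∉ T := by
  induction l with
  | nil => exact h'
  | cons e l ih => exact fun h => ih (hT x e _ h)

/-- Lists of edges are reversed, so a suffix is an initial segment of the path. Proper initial
segments of a boundary path lie in `T`, so no boundary path is a proper initial segment of another.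
-/
theorem eq_of_boundary_of_suffix (hT : ∀ x e l, (x, e :: l) ∈ T → (x, l) ∈ T)
    {x : X} {l l' : List E.Edge} (h : (x, l) ∈ P.boundary T) (h' : (x, l') ∈ P.boundary T)
    (hs : l <:+ l') : l = l' := by
  obtain ⟨s, rfl⟩ := hs
  cases s with
  | nil => rfl
  | cons e s => exact absurd (h'.2.2 e (s ++ l) rfl) (append_notMem hT h.2.1)

/-- A basis that continues its boundary elements by the action of the edges. -/
structure IsSchreierBasis (P : PathModule (ghostAct k ι) X) (T : Set (X × List E.Edge))
    (b : X × List E.Edge → ι → LPA k E) : Prop where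
  tail : ∀ x e l, (x, e :: l) ∈ T → (x, l) ∈ T
  linearIndep : LinearIndepOn k b P.paths
  act : ∀ x e l, (x, e :: l) ∈ P.paths → (x, l) ∉ T →
    b (x, e :: l) = lmul (LPA.ghost k e) (b (x, l))
  vert_mul : ∀ m ∈ P.paths, m ∉ T → lmul (LPA.vert k (P.cls m).2) (b m) = b m

namespace IsSchreierBasis

theorem lmul_ghostPath (h : IsSchreierBasis P T b) {x : X} {l l' : List E.Edge}
    (hp : (x, l') ∈ P.paths) (hT : (x, l') ∉ T) (hl : IsPath (tip (P.root x) l') l) :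
    lmul (LPA.ghostPath k (tip (P.root x) l') l) (b (x, l')) = b (x, l ++ l') := by
  induction l with
  | nil => exact h.vert_mul (x, l') hp hT
  | cons e l ih =>
    rw [LPA.ghostPath, lmul_mul, ih hl.2]
    exact (h.act x e _ (append_mem_paths hp hl).1 (append_notMem h.tail hT)).symm

/-- The boundary elements have dual functionals on the combinations with ghost coefficients. -/
theorem exists_dual (h : IsSchreierBasis P T b) {m : X × List E.Edge} (hm : m ∈ P.boundary T) :
    ∃ φ : (ι → LPA k E) →ₗ[k] LPA k E, ∀ m' ∈ P.boundary T,
      ∀ a ∈ span k {x | ∃ l, IsPath (tip (P.root m'.1) m'.2) l ∧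
          x = LPA.ghostPath k (tip (P.root m'.1) m'.2) l},
        (m' = m → φ (lmul a (b m')) = a) ∧ (m' ≠ m → φ (lmul a (b m')) = 0) := by
  classical
  obtain ⟨x, l⟩ := m
  obtain ⟨φ, hφ⟩ := exists_linearMap_of_linearIndepOn h.linearIndep
    -- The functional strips the boundary path `l` from a basis path that continues it and returns
    -- the remaining ghost path. It is well defined because `b` is linearly independent.
    fun y => if y.1 = x ∧ l <:+ y.2 then
      LPA.ghostPath k (tip (P.root x) l) (y.2.take (y.2.length - l.length)) else 0
  refine ⟨φ, ?_⟩
  rintro ⟨x', l'⟩ hm' a ha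
  induction ha using Submodule.span_induction with
  | mem a ha =>
    obtain ⟨s, hs, rfl⟩ := ha
    simp only at hs ⊢
    rw [h.lmul_ghostPath hm'.1 hm'.2.1 hs, hφ _ (append_mem_paths hm'.1 hs).1]
    constructor
    · rintro heq
      obtain ⟨rfl, rfl⟩ := Prod.mk.inj heq
      simp
    · intro hne
      rw [if_neg]
      rintro ⟨rfl, hsuf⟩
      refine hne ?_
      -- Two boundary paths that begin the same path are comparable, hence equal.
      obtain h1 | h1 := List.suffix_or_suffix_of_suffix hsuf (List.suffix_append s l')
      · rw [eq_of_boundary_of_suffix h.tail hm hm' h1]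
      · rw [eq_of_boundary_of_suffix h.tail hm' hm h1]
  | zero => simp [lmul_zero_left]
  | add a a' _ _ ih ih' =>
    rw [lmul_add_left, map_add]
    exact ⟨fun e => by rw [ih.1 e, ih'.1 e], fun e => by rw [ih.2 e, ih'.2 e, add_zero]⟩
  | smul c a _ ih =>
    rw [lmul_smul_left, map_smul]
    exact ⟨fun e => by rw [ih.1 e], fun e => by rw [ih.2 e, smul_zero]⟩

/-- The boundary elements are independent over the Leavitt path algebra. -/
theorem eq_zero_of_sum_lmul (hE : E.RowFinite) (h : IsSchreierBasis P T b)
    {s : Finset (X × List E.Edge)} (hs : ∀ m ∈ s, m ∈ P.boundary T)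
    {z : X × List E.Edge → LPA k E} (hz : ∀ m, z m * LPA.vert k (P.cls m).2 = z m)
    (hsum : ∑ m ∈ s, lmul (z m) (b m) = 0) {m : X × List E.Edge} (hm : m ∈ s) : z m = 0 := by
  -- Degrees play no role in independence, so the ungraded filtration is used. Multiplying the
  -- relation by ghost edges lowers the level of all coefficients at once until the dual functionals
  -- apply.
  obtain ⟨K, hK⟩ := LPA.exists_mem_level_of_finite (ε := 0) (n := fun _ => 0)
    (a := fun m : s => z m) fun m => LPA.exists_mem_level _
  replace hK : ∀ m ∈ s, z m ∈ LPA.level k E 0 K 0 := fun m hm => hK ⟨m, hm⟩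
  have base (z : X × List E.Edge → LPA k E) (hz : ∀ m, z m * LPA.vert k (P.cls m).2 = z m)
      (hsum : ∑ m ∈ s, lmul (z m) (b m) = 0) (hK : ∀ m ∈ s, z m ∈ LPA.ghostSpan k E 0 0)
      (m) (hm : m ∈ s) : z m = 0 := by
    obtain ⟨φ, hφ⟩ := h.exists_dual (hs m hm)
    have h1 (m') (hm' : m' ∈ s) := hφ m' (hs m' hm') (z m')
      (LPA.mem_span_of_mem_ghostSpan (hK m' hm') (hz m'))
    have := congrArg φ hsum
    rw [map_sum, map_zero, Finset.sum_eq_single m, (h1 m hm).1 rfl] at this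
    · exact this
    · exact fun m' hm' hne => (h1 m' hm').2 hne
    · exact fun h => absurd hm h
  have hmul (c : LPA k E) (z : X × List E.Edge → LPA k E)
      (hsum : ∑ m ∈ s, lmul (z m) (b m) = 0) : ∑ m ∈ s, lmul (c * z m) (b m) = 0 := by
    simp only [lmul_mul, ← map_sum, hsum, map_zero]
  induction K generalizing z m with
  | zero => exact base z hz hsum hK m hm
  | succ K ih =>
    refine LPA.eq_zero_of_ghost_mul hE (fun e => ?_) fun v hv => ?_
    · refine ih (z := fun m => LPA.ghost k e * z m) (fun m => by rw [mul_assoc, hz])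
        (hmul _ z hsum) hm fun m hm => ?_
      simpa using (LPA.mem_level_succ.1 (hK m hm)).1 e
    · exact base (fun m => LPA.vert k v * z m) (fun m => by rw [mul_assoc, hz])
        (hmul _ z hsum) (fun m hm => (LPA.mem_level_succ.1 (hK m hm)).2 v hv) m hm

end IsSchreierBasis

/-- The combinations of the boundary elements over the Leavitt path algebra, of degree `D`. -/
noncomputable def extension (𝒜 : ℤ → Submodule k (LPA k E))
    (P : PathModule (ghostAct (E := E) k ι) X)
    (T : Set (X × List E.Edge)) (b : X × List E.Edge → ι → LPA k E) (D : ℤ) :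
    Submodule k (ι → LPA k E) :=
  span k {r | ∃ m ∈ P.boundary T, ∃ a ∈ 𝒜 ((P.cls m).1 - D),
    a * LPA.vert k (P.cls m).2 = a ∧ r = lmul a (b m)}

variable {𝒜 : ℤ → Submodule k (LPA k E)}

theorem lmul_mem_extension [SetLike.GradedMul 𝒜] {c : LPA k E} {n D D' : ℤ} (hc : c ∈ 𝒜 n) (hD : D' = D - n)
    {r : ι → LPA k E} (hr : r ∈ extension 𝒜 P T b D) : lmul c r ∈ extension 𝒜 P T b D' := by
  suffices h : extension 𝒜 P T b D ≤ (extension 𝒜 P T b D').comap (lmul c) from h hr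
  refine span_le.2 ?_
  rintro _ ⟨m, hm, a, ha, ha', rfl⟩
  refine subset_span ⟨m, hm, c * a, ?_, by rw [mul_assoc, ha'], (lmul_mul c a _).symm⟩
  have := SetLike.mul_mem_graded hc ha
  rwa [show n + ((P.cls m).1 - D) = (P.cls m).1 - D' by rw [hD]; ring] at this

/-- Collects the coefficients of each boundary element, normalized by its end vertex; these become
the entries of the matrix `x` in `exists_diagonal`. -/
theorem exists_coeff_of_mem_extension {D : ℤ} {r : ι → LPA k E}
    (hr : r ∈ extension 𝒜 P T b D) : ∃ z : X × List E.Edge →₀ LPA k E,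
      (∀ m ∈ z.support, m ∈ P.boundary T) ∧ (∀ m, z m ∈ 𝒜 ((P.cls m).1 - D)) ∧
      (∀ m, z m * LPA.vert k (P.cls m).2 = z m) ∧ r = z.sum fun m a => lmul a (b m) := by
  classical
  induction hr using Submodule.span_induction with
  | mem r hr =>
    obtain ⟨m, hm, a, ha, ha', rfl⟩ := hr
    refine ⟨Finsupp.single m a, fun m' hm' => ?_, fun m' => ?_, fun m' => ?_, ?_⟩
    · rw [Finsupp.mem_support_iff, Finsupp.single_apply] at hm'
      split_ifs at hm' with h
      · rwa [← h]
      · exact absurd rfl hm'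
    · rw [Finsupp.single_apply]
      split_ifs with h
      · rwa [← h]
      · exact zero_mem _
    · rw [Finsupp.single_apply]
      split_ifs with h
      · rwa [← h]
      · exact zero_mul _
    · exact (Finsupp.sum_single_index (h := fun m a => lmul a (b m)) (lmul_zero_left _)).symm
  | zero => exact ⟨0, by simp, by simp, by simp, by simp⟩
  | add r r' _ _ h h' =>
    obtain ⟨z, h1, h2, h3, rfl⟩ := h
    obtain ⟨z', h1', h2', h3', rfl⟩ := h'
    refine ⟨z + z', fun m hm => ?_, fun m => add_mem (h2 m) (h2' m), fun m => ?_, ?_⟩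
    · rcases Finset.mem_union.1 (Finsupp.support_add hm) with h | h
      · exact h1 m h
      · exact h1' m h
    · rw [Finsupp.add_apply, add_mul, h3, h3']
    · exact (Finsupp.sum_add_index' (h := fun m a => lmul a (b m)) (fun m => lmul_zero_left _)
        fun m a a' => lmul_add_left a a' _).symm
  | smul c r _ h =>
    obtain ⟨z, h1, h2, h3, rfl⟩ := h
    refine ⟨c • z, fun m hm => h1 m (Finsupp.support_smul hm), fun m => smul_mem _ _ (h2 m),
      fun m => ?_, ?_⟩
    · rw [Finsupp.smul_apply, smul_mul_assoc, h3]
    · rw [Finsupp.sum_smul_index' (h := fun m a => lmul a (b m)) fun m => lmul_zero_left _,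
        Finsupp.smul_sum]
      simp only [lmul_smul_left]

end Extension

/-! ### Diagonalization of idempotent matrices -/

section Diagonal

variable {k : Type*} [Field k] {E : DirGraph} {ι X : Type*}

theorem PathModule.act_mem_comp {M : Type*} [AddCommGroup M] [Module k M]
    {act : E.Edge → M →ₗ[k] M} (P : PathModule act X) (e : E.Edge) (d : ℤ) (r : M)
    (hr : r ∈ P.comp (d, E.src e)) : act e r ∈ P.comp (d + P.step, E.rng e) := by
  have := PathModule.act_mem_span_word (P := P) (e := e) (c := (d, E.src e)) (S := Set.univ)
    (S' := Set.univ) rfl (fun _ _ _ _ => trivial) (r := r) (by simpa [PathModule.comp] using hr)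
  simpa [PathModule.comp] using this

/-- The intersection of a free module with a subspace that is stable under the edges. -/
noncomputable def PathModule.inf {M : Type*} [AddCommGroup M] [Module k M]
    {act : E.Edge → M →ₗ[k] M} (P : PathModule act X) (W : Submodule k M)
    (hW : ∀ e r, r ∈ W → act e r ∈ W) : P.Sub where
  carrier c := P.comp c ⊓ W
  le_comp _ := inf_le_left
  act_mem e d r hr := ⟨P.act_mem_comp e d r hr.1, hW e r hr.2⟩

theorem vert_lmul_of_mem_comp {hE : E.RowFinite} {R : X → ι → LPA k E}
    {ω : X → E.Vert} {deg : X → ℤ} {ε : ℤ} {B : X → (ι → LPA k E) →ₗ[k] LPA k E} {hB}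
    {c : ℤ × E.Vert} {r : ι → LPA k E} (hr : r ∈ (rowModule hE R ω deg ε B hB).comp c) :
    lmul (LPA.vert k c.2) r = r := by
  induction hr using Submodule.span_induction with
  | mem r hr =>
    obtain ⟨⟨x, l⟩, ⟨hp, rfl⟩, rfl⟩ := hr
    change lmul (LPA.vert k (tip (ω x) l)) (lmul (LPA.ghostPath k (ω x) l) (R x)) =
      lmul (LPA.ghostPath k (ω x) l) (R x)
    rw [← lmul_mul, LPA.tip_mul_ghostPath]
  | zero => exact map_zero _
  | add r r' _ _ h h' => rw [map_add, h, h']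
  | smul a r _ h => rw [map_smul, h]

theorem isSchreierBasis_of_sub {hE : E.RowFinite} {R : X → ι → LPA k E}
    {ω : X → E.Vert} {deg : X → ℤ} {ε : ℤ} {B : X → (ι → LPA k E) →ₗ[k] LPA k E} {hB}
    (N : (rowModule hE R ω deg ε B hB).Sub) {T : Set (X × List E.Edge)}
    {b : X × List E.Edge → ι → LPA k E}
    (htail : ∀ x e l, (x, e :: l) ∈ T → (x, l) ∈ T)
    (hind : LinearIndepOn k b (rowModule hE R ω deg ε B hB).paths)
    (hact : ∀ x e l, (x, e :: l) ∈ (rowModule hE R ω deg ε B hB).paths → (x, l) ∉ T →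
      b (x, e :: l) = ghostAct k ι e (b (x, l)))
    (hN : ∀ c, N.carrier c = span k (b '' {m | m ∈ (rowModule hE R ω deg ε B hB).paths ∧ m ∉ T ∧
      (rowModule hE R ω deg ε B hB).cls m = c})) :
    IsSchreierBasis (rowModule hE R ω deg ε B hB) T b where
  tail := htail
  linearIndep := hind
  act := hact
  vert_mul m hm hT := by
    refine vert_lmul_of_mem_comp (N.le_comp _ ?_)
    rw [hN]
    exact subset_span ⟨m, ⟨hm, hT, rfl⟩, rfl⟩

theorem ghostPath_mem {𝒜 : ℤ → Submodule k (LPA k E)} [SetLike.GradedMul 𝒜] {ε : ℤ}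
    (hv : ∀ v, LPA.vert k v ∈ 𝒜 0) (hg : ∀ e, LPA.ghost k e ∈ 𝒜 (-ε)) (u : E.Vert)
    (l : List E.Edge) : LPA.ghostPath k u l ∈ 𝒜 (-(ε * l.length)) := by
  induction l with
  | nil => simpa [LPA.ghostPath] using hv u
  | cons e l ih =>
    have := SetLike.mul_mem_graded (hg e) ih
    rw [LPA.ghostPath, List.length_cons]
    convert this using 1
    push_cast
    ring_nf

variable [DecidableEq ι]

theorem mem_columnModule_comp [Fintype ι] (hE : E.RowFinite) {d : ι → ℤ} {ε D : ℤ}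
    {r : ι → LPA k E}
    (hr : ∀ j, r j ∈ LPA.ghostSpan k E ε (d j - D)) (v : E.Vert) :
    lmul (LPA.vert k v) r ∈ (columnModule (k := k) hE d ε).comp (D, v) := by
  have hsum : lmul (LPA.vert k v) r = ∑ j, Pi.single j (LPA.vert k v * r j) := by
    ext j
    simp [Finset.sum_apply, Pi.single_apply]
  rw [hsum]
  refine sum_mem fun j _ => ?_
  suffices h : LPA.ghostSpan k E ε (d j - D) ≤ ((columnModule (k := k) hE d ε).comp (D, v)).comap
      (LinearMap.single k (fun _ : ι => LPA k E) j ∘ₗ LinearMap.mulLeft k (LPA.vert k v)) from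
    h (hr j)
  refine span_le.2 ?_
  rintro _ ⟨u, l, hl, hn, rfl⟩
  simp only [SetLike.mem_coe, mem_comap, LinearMap.comp_apply, LinearMap.mulLeft_apply,
    LinearMap.coe_single]
  by_cases h : tip u l = v
  · rw [← h, LPA.tip_mul_ghostPath]
    refine subset_span ⟨((j, u), l), ⟨hl, ?_⟩, ?_⟩
    · change (d j + ε * (l.length : ℤ), tip u l) = _
      rw [Prod.mk.injEq]
      exact ⟨by linarith, rfl⟩
    · change lmul (LPA.ghostPath k u l) (Pi.single j (LPA.vert k u)) = _
      ext i
      by_cases hi : i = j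
      · subst hi
        simp [LPA.ghostPath_mul_vert]
      · simp [Pi.single_eq_of_ne hi]
  · rw [LPA.vert_mul_ghostPath k h, Pi.single_zero]
    exact zero_mem _

theorem apply_mem_of_mem_comp {hE : E.RowFinite} {𝒜 : ℤ → Submodule k (LPA k E)}
    [SetLike.GradedMul 𝒜] {ε : ℤ} (hv : ∀ v, LPA.vert k v ∈ 𝒜 0)
    (hg : ∀ e, LPA.ghost k e ∈ 𝒜 (-ε)) {d : ι → ℤ} {c : ℤ × E.Vert} {r : ι → LPA k E}
    (hr : r ∈ (columnModule (k := k) hE d ε).comp c) (j : ι) : r j ∈ 𝒜 (d j - c.1) := by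
  classical
  induction hr using Submodule.span_induction with
  | mem r hr =>
    obtain ⟨⟨⟨i, u⟩, l⟩, ⟨-, rfl⟩, rfl⟩ := hr
    have : (columnModule (k := k) hE d ε).word ((i, u), l) =
        lmul (LPA.ghostPath k u l) (Pi.single i (LPA.vert k u)) := rfl
    rw [this, lmul_apply]
    change _ ∈ 𝒜 (d j - (d i + ε * (l.length : ℤ)))
    by_cases h : j = i
    · subst h
      rw [Pi.single_eq_same, LPA.ghostPath_mul_vert]
      convert ghostPath_mem hv hg u l using 1
      ring_nf
    · rw [Pi.single_eq_of_ne h, mul_zero]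
      exact zero_mem _
  | zero => exact zero_mem _
  | add r r' _ _ h h' => exact add_mem h h'
  | smul a r _ h => exact smul_mem _ _ h

/-- The lattice in `W` generates `W` over the Leavitt path algebra. Induction on the level writes a
row as $\sum_v vr$ and, at a non-sink, $vr=\sum e(e^*r)$, where $e^*r$ is again in `W` and one level
lower; the parts at sinks already have entries in the ghost span. -/
theorem mem_extension_of_mem_level [Fintype ι] {hE : E.RowFinite} {𝒜 : ℤ → Submodule k (LPA k E)}
    [SetLike.GradedMul 𝒜] {ε : ℤ} (hv : ∀ v, LPA.vert k v ∈ 𝒜 0)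
    (he : ∀ e, LPA.edge k e ∈ 𝒜 ε) (hg : ∀ e, LPA.ghost k e ∈ 𝒜 (-ε)) {d : ι → ℤ}
    {W : Submodule k (ι → LPA k E)} (hW : ∀ a r, r ∈ W → lmul a r ∈ W)
    {T : Set ((ι × E.Vert) × List E.Edge)} {b : (ι × E.Vert) × List E.Edge → ι → LPA k E}
    (hb : IsSchreierBasis (columnModule (k := k) hE d ε) T b)
    (hN : ∀ c, (columnModule (k := k) hE d ε).comp c ⊓ W ≤ span k (b ''
      {m | m ∈ (columnModule (k := k) hE d ε).paths ∧ m ∉ T ∧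
        (columnModule (k := k) hE d ε).cls m = c}))
    {K : ℕ} {D : ℤ} {r : ι → LPA k E} (hr : r ∈ W)
    (hK : ∀ j, r j ∈ LPA.level k E ε K (d j - D)) :
    r ∈ extension 𝒜 (columnModule (k := k) hE d ε) T b D := by
  classical
  set P := columnModule (k := k) hE d ε with hP
  -- Every basis element outside `T` is obtained from a boundary element by ghost edges.
  have hbmem : ∀ x l, (x, l) ∈ P.paths → (x, l) ∉ T →
      b (x, l) ∈ extension 𝒜 P T b (P.cls (x, l)).1 := by
    have hbd : ∀ m ∈ P.boundary T, b m ∈ extension 𝒜 P T b (P.cls m).1 := fun m hm =>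
      subset_span ⟨m, hm, LPA.vert k (P.cls m).2, by rw [sub_self]; exact hv _,
        LPA.vert_mul_self k _, (hb.vert_mul m hm.1 hm.2.1).symm⟩
    intro x l
    induction l with
    | nil => exact fun _ h => hbd _ (PathModule.boundary_of_nil h)
    | cons e l ih =>
      intro hp h
      by_cases h' : (x, l) ∈ T
      · exact hbd _ (PathModule.boundary_of_cons hp h h')
      · rw [hb.act x e l hp h', PathModule.cls_cons]
        refine lmul_mem_extension (hg e) ?_ (ih hp.2 h')
        rw [sub_neg_eq_add]; rfl
  have hunit (r : ι → LPA k E) : ∃ S : Finset E.Vert, r = ∑ v ∈ S, lmul (LPA.vert k v) r := by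
    choose S hS using fun j => LPA.exists_sum_vert_mul (r j)
    refine ⟨Finset.univ.biUnion S, ?_⟩
    ext j
    rw [Finset.sum_apply]
    exact (hS j _ (Finset.subset_biUnion_of_mem S (Finset.mem_univ j))).symm
  have base (r : ι → LPA k E) (hr : r ∈ W) (D : ℤ)
      (hK : ∀ j, r j ∈ LPA.ghostSpan k E ε (d j - D)) : r ∈ extension 𝒜 P T b D := by
    obtain ⟨S, hS⟩ := hunit r
    rw [hS]
    refine sum_mem fun v _ => ?_
    refine span_le.2 ?_ (hN (D, v) ⟨mem_columnModule_comp hE hK v, hW _ r hr⟩)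
    rintro _ ⟨⟨x, l⟩, ⟨hp, hT, hc⟩, rfl⟩
    have := hbmem x l hp hT
    rwa [hc] at this
  induction K generalizing r D with
  | zero => exact base r hr D hK
  | succ K ih =>
    obtain ⟨S, hS⟩ := hunit r
    rw [hS]
    refine sum_mem fun v _ => ?_
    by_cases hs : E.IsSink v
    · exact base _ (hW _ r hr) D fun j => (LPA.mem_level_succ.1 (hK j)).2 v hs
    · rw [LPA.vert_eq_sum k (hE v) hs, lmul_sum]
      refine sum_mem fun e _ => ?_
      rw [lmul_mul]
      refine lmul_mem_extension (he e) (D := D + ε) (by ring) (ih (hW _ r hr) fun j => ?_)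
      rw [← sub_sub]
      exact (LPA.mem_level_succ.1 (hK j)).1 e

/-- Every homogeneous idempotent matrix is equivalent to a diagonal matrix of vertices. -/
theorem exists_diagonal (hE : E.RowFinite) (𝒜 : ℤ → Submodule k (LPA k E))
    [SetLike.GradedMul 𝒜] {ε : ℤ} (hv : ∀ v, LPA.vert k v ∈ 𝒜 0)
    (he : ∀ e, LPA.edge k e ∈ 𝒜 ε) (hg : ∀ e, LPA.ghost k e ∈ 𝒜 (-ε)) {n : ℕ}
    (p : Matrix (Fin n) (Fin n) (LPA k E)) (hp : p * p = p) (d : Fin n → ℤ)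
    (hpd : ∀ i j, ∃ K, p i j ∈ LPA.level k E ε K (d j - d i)) :
    ∃ (s : ℕ) (v : Fin s → E.Vert) (δ : Fin s → ℤ) (x : Matrix (Fin n) (Fin s) (LPA k E))
      (y : Matrix (Fin s) (Fin n) (LPA k E)),
      (∀ i j, x i j ∈ 𝒜 (δ j - d i)) ∧ (∀ i j, y i j ∈ 𝒜 (d j - δ i)) ∧ x * y = p ∧
      y * x = Matrix.diagonal fun i => LPA.vert k (v i) := by
  classical
  let P := columnModule (k := k) hE d ε
  -- The row space of `p`: since `p` is idempotent, it consists of the rows fixed by `p`.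
  let W : Submodule k (Fin n → LPA k E) := LinearMap.ker (rowMul p - LinearMap.id)
  have hWmem (r) : r ∈ W ↔ rowMul p r = r := by simp [W, sub_eq_zero]
  have hW (a r) (hr : r ∈ W) : lmul a r ∈ W := by
    rw [hWmem] at hr ⊢
    rw [rowMul_lmul, hr]
  let N : P.Sub := P.inf W fun e r hr => hW _ r hr
  obtain ⟨T, b, -, htail, -, hind, hact, hN⟩ := N.exists_basis
  have hb : IsSchreierBasis P T b := isSchreierBasis_of_sub N htail hind hact hN
  have hbN : ∀ m ∈ P.boundary T, b m ∈ P.comp (P.cls m) ⊓ W := fun m hm => by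
    change b m ∈ N.carrier (P.cls m)
    rw [hN]
    exact subset_span ⟨m, ⟨hm.1, hm.2.1, rfl⟩, rfl⟩
  have hrow (i : Fin n) : p i ∈ extension 𝒜 P T b (d i) := by
    obtain ⟨K, hK⟩ := LPA.exists_mem_level_of_finite (hpd i)
    exact mem_extension_of_mem_level hv he hg hW hb (fun c => (hN c).le)
      ((hWmem _).2 (by rw [rowMul_row, hp])) hK
  choose z hz1 hz2 hz3 hz4 using fun i => exists_coeff_of_mem_extension (hrow i)
  -- The boundary may be infinite, but the rows of `p` involve only finitely many of its elements.
  let s := Finset.univ.biUnion fun i => (z i).support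
  have hs : ∀ m ∈ s, m ∈ P.boundary T := by
    intro m hm
    obtain ⟨i, -, hi⟩ := Finset.mem_biUnion.1 hm
    exact hz1 i m hi
  let σ : Fin s.card ≃ s := s.equivFin.symm
  let x : Matrix (Fin n) (Fin s.card) (LPA k E) := Matrix.of fun i a => z i (σ a)
  let y : Matrix (Fin s.card) (Fin n) (LPA k E) := Matrix.of fun a j => b (σ a) j
  have hsum {M : Type _} [AddCommMonoid M] (F : (Fin n × E.Vert) × List E.Edge → M) :
      ∑ a, F (σ a) = ∑ m ∈ s, F m := by
    rw [Equiv.sum_comp σ fun m : s => F m, Finset.sum_coe_sort]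
  have hxy : x * y = p := by
    ext i j
    rw [Matrix.mul_apply]
    change ∑ a, z i (σ a) * b (σ a) j = _
    rw [hsum fun m => z i m * b m j]
    conv_rhs => rw [hz4 i]
    rw [Finsupp.sum, Finset.sum_apply]
    refine (Finset.sum_subset (Finset.subset_biUnion_of_mem (fun i => (z i).support)
      (Finset.mem_univ i)) fun m _ hm => ?_).symm
    change z i m * b m j = 0
    rw [Finsupp.notMem_support_iff.1 hm, zero_mul]
  have hyp : y * p = y := by
    ext a j
    rw [← rowMul_row]
    exact congrFun ((hWmem _).1 (hbN _ (hs _ (σ a).2)).2) j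
  refine ⟨s.card, fun a => (P.cls (σ a)).2, fun a => (P.cls (σ a)).1, x, y,
    fun i a => hz2 i _, fun a j => ?_, hxy, ?_⟩
  · exact apply_mem_of_mem_comp hv hg (hbN _ (hs _ (σ a).2)).1 j
  · ext a a'
    -- Since the boundary element `b (σ a)` is fixed by `p = x y`, it expands with the coefficients
    -- of row `a` of `y x`. Its trivial expansion has the single coefficient given by its end
    -- vertex. Here `z'` is the difference of the two expansions, and independence makes it vanish.
    let z' : (Fin n × E.Vert) × List E.Edge → LPA k E := fun m =>
      (∑ j, y a j * z j m) - if (σ a : (Fin n × E.Vert) × List E.Edge) = m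
        then LPA.vert k (P.cls m).2 else 0
    have hz' : z' (σ a') = 0 := by
      refine hb.eq_zero_of_sum_lmul hE hs (z := z') (fun m => ?_) ?_ (σ a').2
      · simp only [z', sub_mul, Finset.sum_mul, mul_assoc, ite_mul, zero_mul, LPA.vert_mul_self]
        simp only [P, hz3]
      · ext j
        have h1 : ∑ m ∈ s, (∑ i, y a i * z i m) * b m j = b (σ a) j := by
          have h2 : y * x * y = y := by rw [Matrix.mul_assoc, hxy, hyp]
          have h3 := congrFun (congrFun h2 a) j
          rw [Matrix.mul_apply] at h3
          simp only [Matrix.mul_apply] at h3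
          rw [← hsum fun m => (∑ i, y a i * z i m) * b m j]
          exact h3
        have h4 : LPA.vert k (P.cls (σ a)).2 * b (σ a) j = b (σ a) j :=
          congrFun (hb.vert_mul _ (hs _ (σ a).2).1 (hs _ (σ a).2).2.1) j
        rw [Finset.sum_apply]
        simp only [lmul_apply, z', sub_mul, Finset.sum_sub_distrib, Pi.zero_apply]
        rw [h1, Finset.sum_eq_single (σ a : (Fin n × E.Vert) × List E.Edge), if_pos rfl, h4,
          sub_self]
        · intro m _ hm
          rw [if_neg hm.symm, zero_mul]
        · exact fun h => absurd (σ a).2 h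
    rw [Matrix.mul_apply]
    have h5 := sub_eq_zero.1 hz'
    rw [Matrix.diagonal_apply]
    refine h5.trans ?_
    by_cases h : a = a'
    · subst h; simp
    · rw [if_neg h, if_neg]
      exact fun h' => h (σ.injective (Subtype.ext h'))

end Diagonal

/-! ### Counting the boundary of a finite transversal -/

section Counting

/-- The initial segments of bounded length form a finite set. -/
theorem finite_setOf_isPath {E : DirGraph} (hE : E.RowFinite) (u : E.Vert) (K : ℕ) :
    {l : List E.Edge | IsPath u l ∧ l.length < K}.Finite := by
  induction K with
  | zero => simp
  | succ K ih =>
    refine ((Set.finite_singleton []).union (ih.biUnion fun l _ =>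
      (hE (tip u l)).image fun e => e :: l)).subset ?_
    rintro (_ | ⟨e, l⟩) ⟨hl, hlen⟩
    · exact Or.inl rfl
    · refine Or.inr (Set.mem_biUnion (x := l) ⟨hl.2, by simpa using hlen⟩ ⟨e, hl.1, rfl⟩)

theorem sum_eq_of_card_fiber_eq {α β V H : Type*} [AddCommMonoid H] [DecidableEq V]
    (s : Finset α) (s' : Finset β) (f : α → V) (f' : β → V) (h : V → H)
    (hc : ∀ v, (s.filter fun a => f a = v).card = (s'.filter fun a => f' a = v).card) :
    ∑ a ∈ s, h (f a) = ∑ a ∈ s', h (f' a) := by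
  have : s.val.map f = s'.val.map f' := by
    ext v
    rw [Multiset.count_map, Multiset.count_map]
    have := hc v
    simp only [Finset.card, Finset.filter_val] at this
    simpa only [eq_comm] using this
  have h2 := congrArg (fun m => (m.map h).sum) this
  rw [Multiset.map_map, Multiset.map_map] at h2
  exact h2

variable {k M : Type*} [Field k] [AddCommGroup M] [Module k M] {E : DirGraph} {X : Type*}
  {act : E.Edge → M →ₗ[k] M} {P : PathModule act X} {T : Set (X × List E.Edge)}

namespace PathModule

/-- The classes of the boundary elements of a finite transversal add up to the classes of the
generators. -/
theorem sum_boundary [Fintype X] (hE : E.RowFinite) (hTp : T ⊆ P.paths)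
    (hT : ∀ x e l, (x, e :: l) ∈ T → (x, l) ∈ T) (hfin : T.Finite)
    (hsink : ∀ t ∈ T, ¬ E.IsSink (tip (P.root t.1) t.2)) :
    ∃ B : Finset (X × List E.Edge), (∀ m, m ∈ B ↔ m ∈ P.boundary T) ∧
      ∀ (H : Type*) [AddCommGroup H] (h : E.Vert → H),
        (∀ v, ¬ E.IsSink v → h v = ∑ e ∈ (hE v).toFinset, h (E.rng e)) →
        ∑ m ∈ B, h (tip (P.root m.1) m.2) = ∑ x, h (P.root x) := by
  classical
  -- `R` holds the trivial paths and `C` the one-edge prolongations of members of `T`. Their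
  -- disjoint union is `T` together with its boundary. By the graph relation at non-sinks the sum
  -- over `C` equals that over `T`, so cancelling leaves the boundary against the roots.
  let R : Finset (X × List E.Edge) := Finset.univ.image fun x => (x, [])
  let C : Finset (X × List E.Edge) := hfin.toFinset.biUnion fun t =>
    (hE (tip (P.root t.1) t.2)).toFinset.image fun e => (t.1, e :: t.2)
  have hR (x : X) (l : List E.Edge) : (x, l) ∈ R ↔ l = [] := by
    simp [R, eq_comm]
  have hC (x : X) (l : List E.Edge) : (x, l) ∈ C ↔
      ∃ e l', l = e :: l' ∧ (x, l') ∈ T ∧ E.src e = tip (P.root x) l' := by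
    simp only [C, Finset.mem_biUnion, Set.Finite.mem_toFinset, Finset.mem_image, Prod.mk.injEq,
      Set.mem_ofPred_eq]
    constructor
    · rintro ⟨⟨x', l'⟩, ht, e, he, rfl, rfl⟩
      exact ⟨e, l', rfl, ht, he⟩
    · rintro ⟨e, l', rfl, ht, he⟩
      exact ⟨(x, l'), ht, e, he, rfl, rfl⟩
  have hRC : Disjoint R C := by
    rw [Finset.disjoint_left]
    rintro ⟨x, l⟩ h1 h2
    rw [hR] at h1
    obtain ⟨e, l', h, -⟩ := (hC x l).1 h2
    simp [h1] at h
  have hsub : hfin.toFinset ⊆ R ∪ C := by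
    rintro ⟨x, l⟩ ht
    rw [Set.Finite.mem_toFinset] at ht
    rw [Finset.mem_union, hR, hC]
    cases l with
    | nil => exact Or.inl rfl
    | cons e l => exact Or.inr ⟨e, l, rfl, hT x e l ht, (hTp ht).1⟩
  refine ⟨(R ∪ C) \ hfin.toFinset, ?_, ?_⟩
  · rintro ⟨x, l⟩
    rw [Finset.mem_sdiff, Finset.mem_union, hR, hC, Set.Finite.mem_toFinset]
    constructor
    · rintro ⟨rfl | ⟨e, l', rfl, ht, he⟩, hn⟩
      · exact boundary_of_nil hn
      · exact boundary_of_cons ⟨he, hTp ht⟩ hn ht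
    · rintro ⟨hp, hn, h⟩
      refine ⟨?_, hn⟩
      cases l with
      | nil => exact Or.inl rfl
      | cons e l => exact Or.inr ⟨e, l, rfl, h e l rfl, hp.1⟩
  · intro H _ h hh
    have h1 := Finset.sum_sdiff hsub (f := fun m => h (tip (P.root m.1) m.2))
    rw [Finset.sum_union hRC] at h1
    have h2 : ∑ m ∈ C, h (tip (P.root m.1) m.2) =
        ∑ t ∈ hfin.toFinset, h (tip (P.root t.1) t.2) := by
      rw [Finset.sum_biUnion]
      · refine Finset.sum_congr rfl fun t ht => ?_
        rw [Finset.sum_image (fun e _ e' _ h => by simpa using h),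
          hh _ (hsink t (by simpa using ht))]
        rfl
      · rintro ⟨x, l⟩ _ ⟨x', l'⟩ _ hne
        refine Finset.disjoint_left.2 fun m h1 h2 => hne ?_
        obtain ⟨e, -, rfl⟩ := Finset.mem_image.1 h1
        obtain ⟨e', -, h3⟩ := Finset.mem_image.1 h2
        simp only [Prod.mk.injEq, List.cons.injEq] at h3
        rw [h3.1, h3.2.2]
    rw [h2] at h1
    rw [add_right_cancel h1, Finset.sum_image (fun x _ y _ h => by simpa using h)]
    rfl

/-- The number of boundary elements that end at a vertex depends only on the submodule. -/
theorem finrank_quotient_act {b : X × List E.Edge → M} (hb : LinearIndepOn k b P.paths)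
    (hT : ∀ x e l, (x, e :: l) ∈ T → (x, l) ∈ T)
    (hact : ∀ x e l, (x, e :: l) ∈ P.paths → (x, l) ∉ T → b (x, e :: l) = act e (b (x, l)))
    {N : E.Vert → Submodule k M}
    (hN : ∀ v, N v = span k (b '' {m | m ∈ P.paths ∧ m ∉ T ∧ tip (P.root m.1) m.2 = v}))
    {B : Finset (X × List E.Edge)} (hB : ∀ m, m ∈ B ↔ m ∈ P.boundary T) (v : E.Vert)
    [DecidableEq E.Vert] :
    Module.finrank k ((N v).map
        (span k {r | ∃ e, E.rng e = v ∧ ∃ r' ∈ N (E.src e), r = act e r'}).mkQ) =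
      (B.filter fun m => tip (P.root m.1) m.2 = v).card := by
  classical
  set A := B.filter fun m => tip (P.root m.1) m.2 = v with hA
  -- The basis elements at `v` that prolong another basis element of the submodule. They span the
  -- images of the edges, so the boundary elements at `v` give a basis of the quotient.
  let S : Set (X × List E.Edge) :=
    {m | m ∈ P.paths ∧ m ∉ T ∧ tip (P.root m.1) m.2 = v ∧ m ∉ P.boundary T}
  have hSA : {m | m ∈ P.paths ∧ m ∉ T ∧ tip (P.root m.1) m.2 = v} = S ∪ A := by
    ext m
    have : m ∈ P.boundary T → m ∈ P.paths ∧ m ∉ T := fun h => ⟨h.1, h.2.1⟩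
    simp only [S, hA, Set.mem_union, Set.mem_ofPred_eq, Finset.coe_filter, hB]
    tauto
  have hplus : span k {r | ∃ e, E.rng e = v ∧ ∃ r' ∈ N (E.src e), r = act e r'} =
      span k (b '' S) := by
    apply le_antisymm
    · refine span_le.2 ?_
      rintro _ ⟨e, rfl, r', hr', rfl⟩
      suffices h : N (E.src e) ≤ (span k (b '' S)).comap (act e) from h hr'
      rw [hN]
      refine span_le.2 ?_
      rintro _ ⟨⟨x, l⟩, ⟨hp, ht, htip⟩, rfl⟩
      have hp' : (x, e :: l) ∈ P.paths := ⟨htip.symm, hp⟩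
      rw [SetLike.mem_coe, mem_comap, ← hact x e l hp' ht]
      exact subset_span ⟨_, ⟨hp', fun h => ht (hT x e l h), rfl, fun h => ht (h.2.2 e l rfl)⟩, rfl⟩
    · refine span_le.2 ?_
      rintro _ ⟨⟨x, l⟩, ⟨hp, ht, htip, hbd⟩, rfl⟩
      cases l with
      | nil => exact absurd (boundary_of_nil ht) hbd
      | cons e l =>
        have ht' : (x, l) ∉ T := fun h => hbd (boundary_of_cons hp ht h)
        refine subset_span ⟨e, htip, b (x, l), ?_, hact x e l hp ht'⟩
        rw [hN]
        exact subset_span ⟨_, ⟨hp.2, ht', hp.1.symm⟩, rfl⟩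
  have hdisj : Disjoint S (A : Set (X × List E.Edge)) := by
    rw [Set.disjoint_left]
    intro m h1 h2
    exact h1.2.2.2 ((hB m).1 (Finset.mem_filter.1 h2).1)
  have hind : LinearIndepOn k b (S ∪ A) := hb.mono fun m hm => by
    rw [← hSA] at hm
    exact hm.1
  have hindA := (LinearIndepOn.quotient_iff_union
    (hind.mono Set.subset_union_left) hdisj).2 hind
  rw [hplus, hN, hSA, Submodule.map_span, Set.image_union, Set.image_union, span_union]
  have hzero : span k ((span k (b '' S)).mkQ '' (b '' S)) = ⊥ := by
    rw [span_eq_bot]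
    rintro _ ⟨r, hr, rfl⟩
    exact (Submodule.Quotient.mk_eq_zero _).2 (subset_span hr)
  rw [hzero, bot_sup_eq, ← Set.image_comp, Set.image_eq_range ((span k (b '' S)).mkQ ∘ b)]
  exact (finrank_span_eq_card hindA).trans (Fintype.card_coe A)

/-- The intersection of two free modules. -/
noncomputable def infComp {X' : Type*} (P : PathModule act X) (P' : PathModule act X')
    (h : P'.step = P.step) : P.Sub where
  carrier c := P.comp c ⊓ P'.comp c
  le_comp _ := inf_le_left
  act_mem e d r hr := ⟨P.act_mem_comp e d r hr.1, h ▸ P'.act_mem_comp e d r hr.2⟩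

end PathModule

end Counting

/-! ### Commensurable lattices and invariance of the vertex sum -/

section Comparison

variable {k : Type*} [Field k] {E : DirGraph}

namespace LPA

/-- Each ghost edge lowers the level by one. Level zero is stable under ghost edges, so the
truncated subtraction is correct. -/
theorem ghostPath_mul_mem_level (u : E.Vert) (l : List E.Edge) {K : ℕ} {a : LPA k E}
    (ha : a ∈ level k E 0 K 0) : ghostPath k u l * a ∈ level k E 0 (K - l.length) 0 := by
  induction l with
  | nil => exact vert_mul_mem_level u ha
  | cons e l ih =>
    rw [ghostPath, mul_assoc, List.length_cons, ← Nat.sub_sub]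
    cases h : K - l.length with
    | zero =>
      rw [h] at ih
      simpa using ghost_mul_mem_level e ih
    | succ K' =>
      rw [h] at ih
      simpa using (mem_level_succ.1 ih).1 e

theorem ghostPath_mul_mem_ghostSpan {u : E.Vert} {l : List E.Edge} {K : ℕ} {a : LPA k E}
    (ha : a ∈ level k E 0 K 0) (h : K ≤ l.length ∨ E.IsSink (tip u l)) :
    ghostPath k u l * a ∈ ghostSpan k E 0 0 := by
  have h1 := ghostPath_mul_mem_level u l ha
  obtain h | h := h
  · rwa [Nat.sub_eq_zero_of_le h] at h1
  · have h2 := (mem_level_succ.1 (level_le_succ _ _ h1)).2 _ h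
    rwa [← mul_assoc, tip_mul_ghostPath] at h2

end LPA

variable {ι X X' : Type*} {hE : E.RowFinite}
  {R : X → ι → LPA k E} {ω : X → E.Vert} {B : X → (ι → LPA k E) →ₗ[k] LPA k E} {hB}
  {R' : X' → ι → LPA k E} {ω' : X' → E.Vert} {B' : X' → (ι → LPA k E) →ₗ[k] LPA k E} {hB'}

theorem lmul_vert_mul_mem_comp (x : X) (t : E.Vert) {a : LPA k E}
    (ha : a ∈ span k {a | ∃ l, IsPath (ω x) l ∧ a = LPA.ghostPath k (ω x) l}) :
    lmul (LPA.vert k t * a) (R x) ∈ (rowModule hE R ω (fun _ => 0) 0 B hB).comp (0, t) := by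
  induction ha using Submodule.span_induction with
  | mem a ha =>
    obtain ⟨l, hl, rfl⟩ := ha
    by_cases h : tip (ω x) l = t
    · subst h
      rw [LPA.tip_mul_ghostPath]
      refine subset_span ⟨(x, l), ⟨hl, ?_⟩, rfl⟩
      simp [PathModule.cls, rowModule]
    · rw [LPA.vert_mul_ghostPath k h, lmul_zero_left]
      exact zero_mem _
  | zero => rw [mul_zero, lmul_zero_left]; exact zero_mem _
  | add a a' _ _ h h' => rw [mul_add, lmul_add_left]; exact add_mem h h'
  | smul c a _ h => rw [mul_smul_comm, lmul_smul_left]; exact smul_mem _ _ h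

/-- Long paths, and paths to sinks, belong to a commensurable lattice. -/
theorem exists_bound_of_notMem [Finite X] [Fintype X'] (c : X → X' → LPA k E)
    (hc : ∀ x x', c x x' * LPA.vert k (ω' x') = c x x')
    (hR : ∀ x, R x = ∑ x', lmul (c x x') (R' x')) :
    ∃ K, ∀ x l, IsPath (ω x) l → (K ≤ l.length ∨ E.IsSink (tip (ω x) l)) →
      (rowModule hE R ω (fun _ => 0) 0 B hB).word (x, l) ∈
        (rowModule hE R' ω' (fun _ => 0) 0 B' hB').comp
          ((rowModule hE R ω (fun _ => 0) 0 B hB).cls (x, l)) := by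
  obtain ⟨K, hK⟩ := LPA.exists_mem_level_of_finite (ε := 0) (n := fun _ => 0)
    (a := fun q : X × X' => c q.1 q.2) fun q => LPA.exists_mem_level _
  refine ⟨K, fun x l hl h => ?_⟩
  have hcls : (rowModule hE R ω (fun _ => 0) 0 B hB).cls (x, l) = (0, tip (ω x) l) := by
    simp [PathModule.cls, rowModule]
  rw [hcls]
  change lmul (LPA.ghostPath k (ω x) l) (R x) ∈ _
  rw [hR, map_sum]
  refine sum_mem fun x' _ => ?_
  rw [← lmul_mul]
  have h1 := LPA.ghostPath_mul_mem_ghostSpan (hK (x, x')) h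
  have h2 := LPA.mem_span_of_mem_ghostSpan (u := ω' x') h1 (by rw [mul_assoc, hc])
  have h3 := lmul_vert_mul_mem_comp (hE := hE) (R := R') (B := B') (hB := hB') x'
    (tip (ω x) l) h2
  rwa [← mul_assoc, LPA.tip_mul_ghostPath] at h3

theorem finite_of_bound [Finite X] {T : Set (X × List E.Edge)} (hE : E.RowFinite) {K : ℕ}
    (hT : ∀ t ∈ T, IsPath (ω t.1) t.2 ∧ t.2.length < K) : T.Finite := by
  refine ((Set.finite_univ (α := X)).biUnion fun x _ =>
    (finite_setOf_isPath hE (ω x) K).image (Prod.mk x)).subset ?_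
  rintro ⟨x, l⟩ ht
  exact Set.mem_biUnion (Set.mem_univ x) ⟨l, hT _ ht, rfl⟩

/-- The sums over the generators of two commensurable lattices and over a basis of their
intersection agree. -/
theorem exists_boundary_infComp [Fintype X] [Fintype X'] (c : X → X' → LPA k E)
    (hc : ∀ x x', c x x' * LPA.vert k (ω' x') = c x x')
    (hR : ∀ x, R x = ∑ x', lmul (c x x') (R' x')) {H : Type*} [AddCommGroup H] (h : E.Vert → H)
    (hh : ∀ v, ¬ E.IsSink v → h v = ∑ e ∈ (hE v).toFinset, h (E.rng e))
    {N : E.Vert → Submodule k (ι → LPA k E)}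
    (hN : ∀ v, N v = (rowModule hE R ω (fun _ => 0) 0 B hB).comp (0, v) ⊓
      (rowModule hE R' ω' (fun _ => 0) 0 B' hB').comp (0, v)) [DecidableEq E.Vert] :
    ∃ S : Finset (X × List E.Edge), ∑ m ∈ S, h (tip (ω m.1) m.2) = ∑ x, h (ω x) ∧
      ∀ v, (S.filter fun m => tip (ω m.1) m.2 = v).card = Module.finrank k ((N v).map
        (span k {r | ∃ e, E.rng e = v ∧ ∃ r' ∈ N (E.src e), r = ghostAct k ι e r'}).mkQ) := by
  set P := rowModule hE R ω (fun _ => 0) 0 B hB with hP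
  set P' := rowModule hE R' ω' (fun _ => 0) 0 B' hB' with hP'
  obtain ⟨T, b, hTp, htail, hTN, hind, hact, hbN⟩ := (P.infComp P' rfl).exists_basis
  have hcls (m : X × List E.Edge) : P.cls m = (0, tip (ω m.1) m.2) := by
    simp [PathModule.cls, rowModule, hP]
  obtain ⟨K, hK⟩ := exists_bound_of_notMem (hE := hE) (hB := hB) (hB' := hB') c hc hR
  -- Members of the transversal lie outside the intersection, whereas long paths and paths to sinks
  -- lie inside it. With row-finiteness this makes `T` finite.
  have hbound : ∀ t ∈ T, ¬ (K ≤ t.2.length ∨ E.IsSink (tip (ω t.1) t.2)) := by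
    rintro ⟨x, l⟩ ht hcon
    exact hTN _ ht ⟨subset_span ⟨(x, l), ⟨hTp ht, rfl⟩, rfl⟩, hK x l (hTp ht) hcon⟩
  have hfin : T.Finite := finite_of_bound (ω := ω) hE (K := K) fun t ht =>
    ⟨hTp ht, not_le.1 fun hK => hbound t ht (Or.inl hK)⟩
  obtain ⟨S, hS, hsum⟩ := PathModule.sum_boundary (P := P) hE hTp htail hfin fun t ht hs =>
    hbound t ht (Or.inr hs)
  refine ⟨S, hsum H h hh, fun v => ?_⟩
  refine (PathModule.finrank_quotient_act (P := P) hind htail hact (N := N) (fun v => ?_) hS v).symm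
  rw [hN]
  refine (hbN (0, v)).trans ?_
  simp only [hcls, Prod.mk.injEq, true_and]
  rfl

/-- The two lattices are generated by the rows $w_je_j$ and by the rows of `x`. The entries of `x`
and `y` express each family through the other, and right multiplication by `y` provides the
functionals dual to the rows of `x`. Both computations use the same intersection `N`. -/
theorem sum_eq_of_normalized (hE : E.RowFinite) {m n : ℕ} (v : Fin m → E.Vert)
    (w : Fin n → E.Vert) (x : Matrix (Fin m) (Fin n) (LPA k E))
    (y : Matrix (Fin n) (Fin m) (LPA k E))
    (hxy : x * y = Matrix.diagonal fun i => LPA.vert k (v i))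
    (hyx : y * x = Matrix.diagonal fun j => LPA.vert k (w j))
    (hx : ∀ i j, x i j * LPA.vert k (w j) = x i j) (hy : ∀ j i, y j i * LPA.vert k (v i) = y j i)
    {H : Type*} [AddCommGroup H] (h : E.Vert → H)
    (hh : ∀ v, ¬ E.IsSink v → h v = ∑ e ∈ (hE v).toFinset, h (E.rng e)) :
    ∑ i, h (v i) = ∑ j, h (w j) := by
  classical
  let R : Fin n → Fin n → LPA k E := fun j => Pi.single j (LPA.vert k (w j))
  have hB : ∀ j j' a, LinearMap.proj (R := k) (φ := fun _ => LPA k E) j (lmul a (R j')) =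
      if j' = j then a * LPA.vert k (w j) else 0 := by
    intro j j' a
    simp only [LinearMap.proj_apply, lmul_apply, R]
    split_ifs with hj
    · subst hj; simp
    · rw [Pi.single_eq_of_ne (Ne.symm hj), mul_zero]
  have hB' : ∀ i i' a, (LinearMap.proj (R := k) (φ := fun _ => LPA k E) i ∘ₗ rowMul y)
      (lmul a (x i')) = if i' = i then a * LPA.vert k (v i) else 0 := by
    intro i i' a
    rw [LinearMap.comp_apply, rowMul_lmul, LinearMap.proj_apply, lmul_apply, rowMul_row, hxy,
      Matrix.diagonal_apply]
    split_ifs with hi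
    · rw [hi]
    · exact mul_zero a
  have hRx (j) : R j = ∑ i, lmul (y j i) (x i) := by
    ext l
    have := congrFun (congrFun hyx j) l
    rw [Matrix.mul_apply] at this
    rw [Finset.sum_apply]
    simp only [lmul_apply, this, R, Matrix.diagonal_apply, Pi.single_apply, eq_comm]
  have hxR (i) : x i = ∑ j, lmul (x i j) (R j) := by
    ext l
    rw [Finset.sum_apply]
    simp [R, Pi.single_apply, hx]
  let N : E.Vert → Submodule k (Fin n → LPA k E) := fun u =>
    (rowModule hE R w (fun _ => 0) 0 _ (by convert hB)).comp (0, u) ⊓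
      (rowModule hE (fun i => x i) v (fun _ => 0) 0 _ (by convert hB')).comp (0, u)
  obtain ⟨S, hS, hS'⟩ := exists_boundary_infComp _ hy hRx h hh (N := N) fun u => rfl
  obtain ⟨S', hS1, hS1'⟩ := exists_boundary_infComp _ hx hxR h hh (N := N)
    fun u => inf_comm _ _
  rw [← hS, ← hS1]
  exact sum_eq_of_card_fiber_eq _ _ _ _ h fun u => (hS1' u).trans (hS' u).symm

/-- Diagonal matrices of vertices that are equivalent over the Leavitt path algebra have the same
class in every group in which the vertices satisfy the relations of the graph. -/
theorem sum_eq_of_equivalent_diagonal (hE : E.RowFinite) {m n : ℕ} (v : Fin m → E.Vert)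
    (w : Fin n → E.Vert) (x : Matrix (Fin m) (Fin n) (LPA k E))
    (y : Matrix (Fin n) (Fin m) (LPA k E))
    (hxy : x * y = Matrix.diagonal fun i => LPA.vert k (v i))
    (hyx : y * x = Matrix.diagonal fun j => LPA.vert k (w j))
    {H : Type*} [AddCommGroup H] (h : E.Vert → H)
    (hh : ∀ v, ¬ E.IsSink v → h v = ∑ e ∈ (hE v).toFinset, h (E.rng e)) :
    ∑ i, h (v i) = ∑ j, h (w j) := by
  have hd {l : ℕ} (u : Fin l → E.Vert) : (Matrix.diagonal fun i => LPA.vert k (u i)) *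
      (Matrix.diagonal fun i => LPA.vert k (u i)) = Matrix.diagonal fun i => LPA.vert k (u i) := by
    rw [Matrix.diagonal_mul_diagonal]
    simp only [LPA.vert_mul_self]
  have hvi : (x * y) * (x * y) = x * y := by rw [hxy, hd]
  have hwi : (y * x) * (y * x) = y * x := by rw [hyx, hd]
  -- Multiplying by the idempotents `y x` and `x y` makes each entry absorb the vertex of its
  -- column, and the two products are unchanged because they are idempotent.
  refine sum_eq_of_normalized hE v w (x * (y * x)) (y * (x * y)) ?_ ?_ ?_ ?_ h hh
  · rw [← hxy, ← Matrix.mul_assoc x y x, Matrix.mul_assoc (x * y) x, ← Matrix.mul_assoc x y,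
      hvi, hvi]
  · rw [← hyx, ← Matrix.mul_assoc y x y, Matrix.mul_assoc (y * x) y, ← Matrix.mul_assoc y x,
      hwi, hwi]
  · intro i j
    rw [hyx, Matrix.mul_diagonal, mul_assoc, LPA.vert_mul_self]
  · intro j i
    rw [hxy, Matrix.mul_diagonal, mul_assoc, LPA.vert_mul_self]

end Comparison

/-! ### The shift on graded classes -/

section Shift

theorem append_sub_one {m n : ℕ} (c : Fin m → ℤ) (d : Fin n → ℤ) (i : Fin (m + n)) :
    Fin.append (fun i => c i - 1) (fun i => d i - 1) i = Fin.append c d i - 1 := by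
  refine Fin.addCases (fun i => ?_) (fun i => ?_) i <;> simp

theorem eq_append_last {α : Type*} {s : ℕ} (v : Fin (s + 1) → α) :
    v = Fin.append (fun i : Fin s => v i.castSucc) (fun _ : Fin 1 => v (Fin.last s)) := by
  rw [Fin.append_right_eq_snoc]
  exact (Fin.snoc_init_self v).symm

variable {A : Type*} [NonUnitalRing A] {S : Type*} [SetLike S A] {𝒜 : ℤ → S}

/-- The shift of a graded idempotent matrix. -/
def GrIdemMat.shiftOne (P : GrIdemMat 𝒜) : GrIdemMat 𝒜 where
  toIdemMat := P.toIdemMat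
  shift i := P.shift i - 1
  mem i j := by rw [sub_sub_sub_cancel_right]; exact P.mem i j

variable [AddSubmonoidClass S A] [SetLike.GradedMul 𝒜]

theorem VGr.mk_eq_of_mat_eq {P Q : GrIdemMat 𝒜} (σ : Fin Q.size ≃ Fin P.size)
    (h : Q.mat = P.mat.submatrix σ σ) (hs : ∀ i, Q.shift i = P.shift (σ i)) :
    VGr.mk P = VGr.mk Q :=
  Quotient.sound (GrIdemMat.equivalent_of_submatrix P Q σ h hs)

/-- The shift homomorphism of `V^gr(A)`. -/
def VGr.shiftOne (𝒜 : ℤ → S) [SetLike.GradedMul 𝒜] : VGr 𝒜 →+ VGr 𝒜 where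
  toFun := Quotient.map GrIdemMat.shiftOne fun _ _ ⟨x, y, hx, hy, h, h'⟩ =>
    ⟨x, y, fun i j => by simpa [GrIdemMat.shiftOne] using hx i j,
      fun i j => by simpa [GrIdemMat.shiftOne] using hy i j, h, h'⟩
  map_zero' := VGr.mk_eq_of_mat_eq (P := (GrIdemMat.empty 𝒜).shiftOne) (Q := GrIdemMat.empty 𝒜)
    (Equiv.refl _) rfl fun i => i.elim0
  map_add' a b := by
    induction a, b using Quotient.inductionOn₂ with
    | _ P Q =>
      exact VGr.mk_eq_of_mat_eq (P := (P.sum Q).shiftOne) (Q := P.shiftOne.sum Q.shiftOne)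
        (Equiv.refl _) rfl fun i => append_sub_one P.shift Q.shift i

/-- The shift homomorphism of `K₀^gr(A)`. -/
noncomputable def shiftHom (𝒜 : ℤ → S) [SetLike.GradedMul 𝒜] : K0Gr 𝒜 →+ K0Gr 𝒜 :=
  Algebra.GrothendieckAddGroup.lift (Algebra.GrothendieckAddGroup.of.comp (VGr.shiftOne 𝒜))

end Shift

/-! ### Group completions -/

section Grothendieck

variable {M G : Type*} [AddCommMonoid M] [AddCommGroup G]

theorem grothendieck_lift_of (f : M →+ G) (a : M) :
    Algebra.GrothendieckAddGroup.lift f (Algebra.GrothendieckAddGroup.of a) = f a :=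
  DFunLike.congr_fun (Algebra.GrothendieckAddGroup.lift.symm_apply_apply f) a

theorem grothendieck_exists_sub (x : Algebra.GrothendieckAddGroup M) : ∃ a b : M,
    x = Algebra.GrothendieckAddGroup.of a - Algebra.GrothendieckAddGroup.of b := by
  obtain ⟨⟨a, b⟩, h⟩ := (AddLocalization.addMonoidOf (⊤ : AddSubmonoid M)).surj x
  exact ⟨a, b, eq_sub_of_add_eq h⟩

theorem grothendieck_of_eq {a b : M}
    (h : Algebra.GrothendieckAddGroup.of a = Algebra.GrothendieckAddGroup.of b) :
    ∃ c, a + c = b + c := by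
  obtain ⟨c, hc⟩ := (AddLocalization.addMonoidOf (⊤ : AddSubmonoid M)).eq_iff_exists.1 h
  exact ⟨c, by rwa [add_comm a, add_comm b]⟩

end Grothendieck

/-! ### Vertex classes, generators and the kernel of the forgetful homomorphism -/

section Classes

variable {k : Type*} [Field k] {E : DirGraph}

/-- The diagonal matrix of vertices. -/
noncomputable def diagIdem (k : Type*) [Field k] {E : DirGraph} {s : ℕ} (v : Fin s → E.Vert)
    (d : Fin s → ℤ) : GrIdemMat (LPA.grading k E) where
  size := s
  mat := Matrix.diagonal fun i => LPA.vert k (v i)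
  mul_self := by
    rw [Matrix.diagonal_mul_diagonal]
    simp only [LPA.vert_mul_self]
  shift := d
  mem i j := by
    rw [Matrix.diagonal_apply]
    split_ifs with h
    · rw [h, sub_self]; exact LPA.vert_mem k _
    · exact zero_mem _

theorem mk_diagIdem_append {s t : ℕ} (v : Fin s → E.Vert) (d : Fin s → ℤ) (w : Fin t → E.Vert)
    (d' : Fin t → ℤ) : VGr.mk (diagIdem k (Fin.append v w) (Fin.append d d')) =
      VGr.mk (diagIdem k v d) + VGr.mk (diagIdem k w d') := by
  refine (VGr.mk_eq_of_mat_eq (P := (diagIdem k v d).sum (diagIdem k w d'))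
    (Q := diagIdem k (Fin.append v w) (Fin.append d d')) (Equiv.refl _) ?_ fun i => rfl).symm
  change Matrix.diagonal (fun i => LPA.vert k (Fin.append v w i)) =
    (blockSum (Matrix.diagonal fun i => LPA.vert k (v i))
      (Matrix.diagonal fun i => LPA.vert k (w i))).submatrix id id
  ext i j
  refine Fin.addCases (fun i => ?_) (fun i => ?_) i <;>
  refine Fin.addCases (fun j => ?_) (fun j => ?_) j <;>
  simp [blockSum, Matrix.diagonal_apply, Fin.ext_iff]

theorem mk_diagIdem {s : ℕ} (v : Fin s → E.Vert) (d : Fin s → ℤ) :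
    VGr.mk (diagIdem k v d) = ∑ i, VGr.mk (vertIdem k (v i) (-d i)) := by
  induction s with
  | zero =>
    exact VGr.mk_eq_of_mat_eq (P := diagIdem k v d) (Q := GrIdemMat.empty _) (Equiv.refl _)
      (Matrix.ext fun i => i.elim0) fun i => i.elim0
  | succ s ih =>
    rw [Fin.sum_univ_castSucc, ← ih]
    conv_lhs => rw [eq_append_last v, eq_append_last d]
    rw [mk_diagIdem_append]
    congr 1
    refine VGr.mk_eq_of_mat_eq (P := diagIdem k (fun _ : Fin 1 => v (Fin.last s)) _)
      (Q := vertIdem k _ _) (Equiv.refl _) ?_ fun i => neg_neg _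
    change (Matrix.of fun _ _ => LPA.vert k (v (Fin.last s)) : Matrix (Fin 1) (Fin 1) (LPA k E)) =
      Matrix.diagonal fun _ : Fin 1 => LPA.vert k (v (Fin.last s))
    ext i j
    rw [Subsingleton.elim i j, Matrix.diagonal_apply_eq]
    rfl

theorem exists_eq_mk_diagIdem (hE : E.RowFinite) (a : VGr (LPA.grading k E)) :
    ∃ (s : ℕ) (v : Fin s → E.Vert) (d : Fin s → ℤ), a = VGr.mk (diagIdem k v d) := by
  induction a using Quotient.inductionOn with
  | _ P =>
    obtain ⟨s, v, δ, x, y, hx, hy, hxy, hyx⟩ := exists_diagonal hE (LPA.grading k E) (ε := 1)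
      (LPA.vert_mem k) (LPA.edge_mem k) (LPA.ghost_mem k) P.mat P.mul_self P.shift
      fun i j => LPA.exists_mem_level_of_mem_grading (P.mem i j)
    exact ⟨s, v, δ, Quotient.sound ⟨x, y, hx, hy, hxy, hyx⟩⟩

theorem exists_eq_forget_diagIdem (hE : E.RowFinite) (a : VMon (LPA k E)) :
    ∃ (s : ℕ) (v : Fin s → E.Vert),
      a = VGr.forget (LPA.grading k E) (VGr.mk (diagIdem k v fun _ => 0)) := by
  induction a using Quotient.inductionOn with
  | _ P =>
    -- Taking every component to be the whole algebra and `ε = 0` turns the graded diagonalization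
    -- into the ungraded one.
    let 𝒜 : ℤ → Submodule k (LPA k E) := fun _ => ⊤
    have : SetLike.GradedMul 𝒜 := { mul_mem := by intros; trivial }
    obtain ⟨s, v, δ, x, y, -, -, hxy, hyx⟩ := exists_diagonal hE 𝒜 (ε := 0)
      (fun _ => trivial) (fun _ => trivial) (fun _ => trivial) P.mat P.mul_self (fun _ => 0)
      fun i j => LPA.exists_mem_level _
    exact ⟨s, v, Quotient.sound ⟨x, y, hxy, hyx⟩⟩

/-- The row of edges leaving `v` and the column of their ghosts multiply to $\sum ee^*=v$ one way
and to the diagonal matrix of ranges the other way. Edges have degree one, which lowers the index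
from `i` to `i - 1`. -/
theorem mk_vertIdem_eq_sum (hE : E.RowFinite) {v : E.Vert} (hv : ¬ E.IsSink v) (i : ℤ) :
    VGr.mk (vertIdem k v i) = ∑ e ∈ (hE v).toFinset, VGr.mk (vertIdem k (E.rng e) (i - 1)) := by
  classical
  set F := (hE v).toFinset with hF
  let σ : Fin F.card ≃ F := F.equivFin.symm
  have hsrc (a) : E.src (σ a) = v :=
    (Set.Finite.mem_toFinset (hE v)).1 (σ a).2
  have h1 : VGr.mk (vertIdem k v i) =
      VGr.mk (diagIdem k (fun a => E.rng (σ a)) fun _ => 1 - i) := by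
    refine Quotient.sound ⟨Matrix.of fun _ a => LPA.edge k (σ a : E.Edge),
      Matrix.of fun a _ => LPA.ghost k (σ a : E.Edge), fun _ a => ?_, fun a _ => ?_, ?_, ?_⟩
    · change _ ∈ LPA.grading k E (1 - i - -i)
      rw [sub_neg_eq_add, sub_add_cancel]
      exact LPA.edge_mem k _
    · change _ ∈ LPA.grading k E (-i - (1 - i))
      rw [show -i - (1 - i) = -1 by ring]
      exact LPA.ghost_mem k _
    · ext _ _
      rw [Matrix.mul_apply]
      change ∑ a : Fin F.card, LPA.edge k (σ a : E.Edge) * LPA.ghost k (σ a : E.Edge) =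
        LPA.vert k v
      rw [LPA.vert_eq_sum k (hE v) hv,
        Equiv.sum_comp σ fun e : F => LPA.edge k (e : E.Edge) * LPA.ghost k (e : E.Edge)]
      exact Finset.sum_coe_sort F fun e => LPA.edge k e * LPA.ghost k e
    · have h2 (a b : Fin F.card) : LPA.ghost k (σ a : E.Edge) * LPA.edge k (σ b : E.Edge) =
          Matrix.diagonal (fun a => LPA.vert k (E.rng (σ a))) a b := by
        rw [Matrix.diagonal_apply]
        split_ifs with h
        · rw [h, LPA.ghost_mul_edge_self]
        · exact LPA.ghost_mul_edge k fun h' => h (σ.injective (Subtype.ext h'))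
      ext a b
      rw [Matrix.mul_apply]
      exact (Fin.sum_univ_one _).trans (h2 a b)
  rw [h1, mk_diagIdem]
  simp only [neg_sub]
  rw [Equiv.sum_comp σ fun e : F => VGr.mk (vertIdem k (E.rng e) (i - 1))]
  exact Finset.sum_coe_sort F fun e => VGr.mk (vertIdem k (E.rng e) (i - 1))

theorem shiftHom_vertClass (v : E.Vert) (i : ℤ) :
    shiftHom (LPA.grading k E) (vertClass k v i) = vertClass k v (i + 1) := by
  rw [shiftHom, vertClass, grothendieck_lift_of, vertClass, AddMonoidHom.comp_apply]
  congr 1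
  exact VGr.mk_eq_of_mat_eq (P := (vertIdem k v i).shiftOne) (Q := vertIdem k v (i + 1))
    (Equiv.refl _) rfl fun _ => by
      change -(i + 1) = -i - 1
      ring

theorem of_mk_diagIdem {s : ℕ} (v : Fin s → E.Vert) (d : Fin s → ℤ) :
    (Algebra.GrothendieckAddGroup.of (VGr.mk (diagIdem k v d)) : K0Gr (LPA.grading k E)) =
      ∑ i, vertClass k (v i) (-d i) := by
  rw [mk_diagIdem, map_sum]; rfl

theorem closure_vertClass (hE : E.RowFinite) :
    AddSubgroup.closure {x : K0Gr (LPA.grading k E) | ∃ v i, x = vertClass k v i} = ⊤ := by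
  refine eq_top_iff.2 fun x _ => ?_
  have key (a : VGr (LPA.grading k E)) : Algebra.GrothendieckAddGroup.of a ∈
      AddSubgroup.closure {x : K0Gr (LPA.grading k E) | ∃ v i, x = vertClass k v i} := by
    obtain ⟨s, v, d, rfl⟩ := exists_eq_mk_diagIdem hE a
    rw [of_mk_diagIdem]
    exact sum_mem fun i _ => AddSubgroup.subset_closure ⟨_, _, rfl⟩
  obtain ⟨a, b, rfl⟩ := grothendieck_exists_sub x
  exact sub_mem (key a) (key b)

theorem forgetHom_of (a : VGr (LPA.grading k E)) :
    forgetHom (LPA.grading k E) (Algebra.GrothendieckAddGroup.of a) =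
      Algebra.GrothendieckAddGroup.of (VGr.forget (LPA.grading k E) a) := by
  rw [forgetHom, grothendieck_lift_of]; rfl

theorem forgetHom_vertClass (v : E.Vert) (i j : ℤ) :
    forgetHom (LPA.grading k E) (vertClass k v i) =
      forgetHom (LPA.grading k E) (vertClass k v j) := by
  rw [vertClass, vertClass, forgetHom_of, forgetHom_of]; rfl

theorem forgetHom_surjective (hE : E.RowFinite) :
    Function.Surjective (forgetHom (LPA.grading k E)) := by
  intro x
  obtain ⟨a, b, rfl⟩ := grothendieck_exists_sub x
  obtain ⟨s, v, rfl⟩ := exists_eq_forget_diagIdem hE a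
  obtain ⟨t, w, rfl⟩ := exists_eq_forget_diagIdem hE b
  exact ⟨Algebra.GrothendieckAddGroup.of (VGr.mk (diagIdem k v fun _ => 0)) -
    Algebra.GrothendieckAddGroup.of (VGr.mk (diagIdem k w fun _ => 0)), by
      rw [map_sub, forgetHom_of, forgetHom_of]⟩

/-- The kernel of the forgetful homomorphism is contained in every subgroup that contains the
differences of the classes of the vertices and their shifts. -/
theorem mem_of_forgetHom_eq_zero (hE : E.RowFinite) {G : AddSubgroup (K0Gr (LPA.grading k E))}
    (hG : ∀ v i, vertClass k v (i + 1) - vertClass k v i ∈ G) {x : K0Gr (LPA.grading k E)}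
    (hx : forgetHom (LPA.grading k E) x = 0) : x ∈ G := by
  let q := QuotientAddGroup.mk' G
  have hstep (v : E.Vert) (i : ℤ) : q (vertClass k v (i + 1)) = q (vertClass k v i) := by
    rw [← sub_eq_zero, ← map_sub]
    exact (QuotientAddGroup.eq_zero_iff _).2 (hG v i)
  have hshift (v : E.Vert) (i : ℤ) : q (vertClass k v i) = q (vertClass k v 0) := by
    induction i using Int.induction_on with
    | zero => rfl
    | succ i ih => rw [hstep, ih]
    | pred i ih => rw [← ih, ← hstep v (-i - 1), sub_add_cancel]
  -- Modulo `G` the index of a vertex class is irrelevant, so the graded relation, which changes the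
  -- index by one, becomes the graph relation for `h`.
  let h : E.Vert → K0Gr (LPA.grading k E) ⧸ G := fun v => q (vertClass k v 0)
  have hh : ∀ v, ¬ E.IsSink v → h v = ∑ e ∈ (hE v).toFinset, h (E.rng e) := by
    intro v hv
    have := congrArg (fun a => q (Algebra.GrothendieckAddGroup.of a))
      (mk_vertIdem_eq_sum (k := k) hE hv 0)
    simp only [map_sum] at this
    refine this.trans (Finset.sum_congr rfl fun e _ => hshift _ _)
  have hsum {s : ℕ} (v : Fin s → E.Vert) (d : Fin s → ℤ) :
      q (Algebra.GrothendieckAddGroup.of (VGr.mk (diagIdem k v d))) = ∑ i, h (v i) := by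
    rw [of_mk_diagIdem, map_sum]
    exact Finset.sum_congr rfl fun i _ => hshift _ _
  obtain ⟨a, b, rfl⟩ := grothendieck_exists_sub x
  rw [map_sub, forgetHom_of, forgetHom_of, sub_eq_zero] at hx
  obtain ⟨c, hc⟩ := grothendieck_of_eq hx
  obtain ⟨s, v, d, rfl⟩ := exists_eq_mk_diagIdem hE a
  obtain ⟨t, w, d', rfl⟩ := exists_eq_mk_diagIdem hE b
  -- The stabilizing class `c` is ungraded. Writing it as a diagonal matrix of vertices puts both
  -- sides in diagonal form, and its contribution to the two sums of `h` cancels.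
  obtain ⟨r, u, rfl⟩ := exists_eq_forget_diagIdem hE c
  rw [← map_add, ← map_add, ← mk_diagIdem_append, ← mk_diagIdem_append] at hc
  obtain ⟨x, y, hxy, hyx⟩ := Quotient.exact hc
  have key := sum_eq_of_equivalent_diagonal hE (Fin.append v u) (Fin.append w u) x y hxy hyx h hh
  rw [Fin.sum_univ_add, Fin.sum_univ_add] at key
  simp only [Fin.append_left, Fin.append_right] at key
  rw [← QuotientAddGroup.eq_zero_iff]
  change q _ = 0
  rw [map_sub, hsum, hsum, add_right_cancel key, sub_self]

end Classes

end Leavitt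

/-! ### The exact sequence -/

theorem mainTheorem8 {k : Type*} [Field k] (E : DirGraph) (hE : E.RowFinite) :
    ∃ φ : Leavitt.K0Gr (Leavitt.LPA.grading k E) →+ Leavitt.K0Gr (Leavitt.LPA.grading k E),
      (∀ (v : E.Vert) (i : ℤ),
        φ (Leavitt.vertClass k v i) = Leavitt.vertClass k v (i + 1) - Leavitt.vertClass k v i) ∧
      (∀ ψ : Leavitt.K0Gr (Leavitt.LPA.grading k E) →+ Leavitt.K0Gr (Leavitt.LPA.grading k E),
        (∀ (v : E.Vert) (i : ℤ),
          ψ (Leavitt.vertClass k v i) =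
            Leavitt.vertClass k v (i + 1) - Leavitt.vertClass k v i) → ψ = φ) ∧
      Function.Exact φ (Leavitt.forgetHom (Leavitt.LPA.grading k E)) ∧
      Function.Surjective (Leavitt.forgetHom (Leavitt.LPA.grading k E)) := by
  -- The shift is defined on all of $K_0^{\rm gr}$, so `φ` needs no presentation of the group by
  -- vertex classes; that they generate is used for uniqueness and for $U\circ\phi=0$.
  let φ := Leavitt.shiftHom (Leavitt.LPA.grading k E) - AddMonoidHom.id _
  have hφ : ∀ (v : E.Vert) (i : ℤ),
      φ (Leavitt.vertClass k v i) = Leavitt.vertClass k v (i + 1) - Leavitt.vertClass k v i :=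
    fun v i => by simp [φ, Leavitt.shiftHom_vertClass]
  refine ⟨φ, hφ, fun ψ hψ => ?_, fun x => ⟨fun hx => ?_, ?_⟩, Leavitt.forgetHom_surjective hE⟩
  · refine AddMonoidHom.eq_of_eqOn_dense (Leavitt.closure_vertClass hE) ?_
    rintro _ ⟨v, i, rfl⟩
    rw [hψ, hφ]
  · exact Leavitt.mem_of_forgetHom_eq_zero hE (G := φ.range)
      (fun v i => ⟨Leavitt.vertClass k v i, hφ v i⟩) hx
  · rintro ⟨x, rfl⟩
    have : (Leavitt.forgetHom (Leavitt.LPA.grading k E)).comp φ = 0 := by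
      refine AddMonoidHom.eq_of_eqOn_dense (Leavitt.closure_vertClass hE) ?_
      rintro _ ⟨v, i, rfl⟩
      rw [AddMonoidHom.comp_apply, hφ, map_sub, Leavitt.forgetHom_vertClass v (i + 1) i, sub_self]
      rfl
    exact DFunLike.congr_fun this x
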